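/- Let $\mathsf{HA}$ be intuitionistic first-order arithmetic with equality, with a function symbol for (each definition of) each primitive recursive function together with its defining equations, the successor axioms, and induction for all formulas. The logical constants are $\bot,\land,\lor,\to,\forall,\exists$; $\neg\varphi$ is $\varphi\to\bot$; $\varphi\leftrightarrow\psi$ is $(\varphi\to\psi)\land(\psi\to\varphi)$; $\mathrm{FV}(\varphi)$ is the set of free variables of $\varphi$. Let $\mathsf{PA}$ be $\mathsf{HA}$ plus the scheme $\varphi\lor\neg\varphi$. *Classes of formulas.* $\Sigma_0=\Pi_0$ is the class of quantifier-free formulas; $\Pi_{k+1}$ (resp. $\Sigma_{k+1}$) is the class of formulas $Q_1\overline{x_1}\cdots Q_{k+1}\overline{x_{k+1}}\,\varphi$ with $\varphi$ quantifier-free, each $\overline{x_i}$ a non-empty list of variables, and $Q_1,Q_2,\dots$ alternating between $\forall$ and $\exists$ starting with $\forall$ (resp. $\exists$). The set $\mathrm{Alt}(\varphi)$ of alternation paths of $\varphi$ (finite sequences in which $+$ and $-$ alternate) is defined recursively, writing $s^\perp$ for $s$ with $+$ and $-$ switched: $\mathrm{Alt}(\varphi)=\{\langle\,\rangle\}$ if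 $\varphi$ is quantifier-free; otherwise $\mathrm{Alt}(\neg\varphi)=\{s^\perp: s\in\mathrm{Alt}(\varphi)\}$; $\mathrm{Alt}(\varphi\land\psi)=\mathrm{Alt}(\varphi\lor\psi)=\mathrm{Alt}(\varphi)\cup\mathrm{Alt}(\psi)$; $\mathrm{Alt}(\varphi\to\psi)=\{s^\perp: s\in\mathrm{Alt}(\varphi)\}\cup\mathrm{Alt}(\psi)$ for $\psi\not\equiv\bot$; $\mathrm{Alt}(\forall x\,\varphi)$ (resp. $\mathrm{Alt}(\exists x\,\varphi)$) is obtained from $\mathrm{Alt}(\varphi)$ by prefixing $-$ (resp. $+$) to every path that does not already begin with $-$ (resp. $+$). Let $\mathrm{F}_k$ be the class of formulas whose longest alternation path has length $k$, let $\mathrm{U}_0=\mathrm{F}_0$, and let $\mathrm{U}_{k+1}$ be the class of $\varphi\in\mathrm{F}_{k+1}$ such that every $s\in\mathrm{Alt}(\varphi)$ of length $k+1$ begins with $-$. *The principle.* $(\Pi_k\lor\Pi_k)\text{-}\mathrm{DNE}$ is the scheme $\forall x\,\bigl(\neg\neg(\varphi(x)\lor\psi(x))\to\varphi(x)\lor\psi(x)\bigr)$,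 where $\varphi(x),\psi(x)\in\Pi_k$ have no free variables other than $x$. A theory proves a scheme if it proves every instance of it. **Theorem.** Let $T$ be a theory (a set of axioms in the language of $\mathsf{HA}$, with intuitionistic first-order logic) in between $\mathsf{HA}$ and $\mathsf{PA}$, i.e. every theorem of $\mathsf{HA}$ is a theorem of $T$ and every theorem of $T$ is a theorem of $\mathsf{PA}$, and let $k$ be a natural number. Then $$T\vdash(\Pi_k\lor\Pi_k)\text{-}\mathrm{DNE}$$ if and only if for all $k'\le k$ and every $\varphi\in\mathrm{U}_{k'}$ there exists $\varphi'\in\Pi_{k'}$ such that $\mathrm{FV}(\varphi)=\mathrm{FV}(\varphi')$ and $T\vdash\varphi\leftrightarrow\varphi'$. -/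

import Mathlib

namespace SemiClassical

/-! ## The language: function symbols for all primitive recursive functions -/

/-- `PRSym n` : the `n`-ary function symbols, one for every definition of a primitive recursive
function (built from zero, successor and projections by composition and primitive recursion). -/
inductive PRSym : ℕ → Type
  | zero : PRSym 0
  | succ : PRSym 1
  | proj {n : ℕ} (i : Fin n) : PRSym n
  | comp {m n : ℕ} (f : PRSym m) (g : Fin m → PRSym n) : PRSym n
  | prec {n : ℕ} (f : PRSym n) (g : PRSym (n + 2)) : PRSym (n + 1)

/-- The first-order language of arithmetic with these function symbols; equality is the only
predicate. -/
def arithLang : FirstOrder.Language.{0, 0} := ⟨PRSym, fun _ => Empty⟩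

/-- Terms with variables `0, 1, 2, …`. -/
abbrev Tm : Type := arithLang.Term ℕ

namespace Tm

/-- The variable with index `n`. -/
def v (n : ℕ) : Tm := FirstOrder.Language.Term.var n

/-- Application of a function symbol. -/
def app {n : ℕ} (f : PRSym n) (ts : Fin n → Tm) : Tm :=
  FirstOrder.Language.Term.func (L := arithLang) f ts

/-- The constant `0`. -/
def zero : Tm := app PRSym.zero ![]

/-- The successor of a term. -/
def succ (t : Tm) : Tm := app PRSym.succ ![t]

end Tm

/-- Formulas over all the logical constants `⊥, ∧, ∨, →, ∀, ∃`.  Variables are de Bruijn indices: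
in `all φ` and `ex φ` the quantifier binds the variable `0` of `φ`, and the variable `n + 1` of `φ`
is the variable `n` of the quantified formula. -/
inductive Formula : Type
  | falsum : Formula
  | eq (s t : Tm) : Formula
  | conj (φ ψ : Formula) : Formula
  | disj (φ ψ : Formula) : Formula
  | imp (φ ψ : Formula) : Formula
  | all (φ : Formula) : Formula
  | ex (φ : Formula) : Formula

namespace Formula

/-- Negation `¬ φ` is `φ → ⊥`. -/
abbrev neg (φ : Formula) : Formula := imp φ falsum

/-- `φ ↔ ψ` is `(φ → ψ) ∧ (ψ → φ)`. -/
abbrev iff (φ ψ : Formula) : Formula := conj (imp φ ψ) (imp ψ φ)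

/-- The set of free variables. -/
def fv : Formula → Set ℕ
  | falsum => ∅
  | eq s t => ↑s.varFinset ∪ ↑t.varFinset
  | conj φ ψ => φ.fv ∪ ψ.fv
  | disj φ ψ => φ.fv ∪ ψ.fv
  | imp φ ψ => φ.fv ∪ ψ.fv
  | all φ => {n | n + 1 ∈ φ.fv}
  | ex φ => {n | n + 1 ∈ φ.fv}

/-- Quantifier-free formulas. -/
def QF : Formula → Prop
  | falsum => True
  | eq _ _ => True
  | conj φ ψ => φ.QF ∧ ψ.QF
  | disj φ ψ => φ.QF ∧ ψ.QF
  | imp φ ψ => φ.QF ∧ ψ.QF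
  | all _ => False
  | ex _ => False

/-- A substitution, pushed under a quantifier. -/
def up (σ : ℕ → Tm) : ℕ → Tm
  | 0 => Tm.v 0
  | n + 1 => (σ n).relabel Nat.succ

/-- Simultaneous (capture-avoiding) substitution of `σ n` for the free variable `n`. -/
def subst : Formula → (ℕ → Tm) → Formula
  | falsum, _ => falsum
  | eq s t, σ => eq (s.subst σ) (t.subst σ)
  | conj φ ψ, σ => conj (φ.subst σ) (ψ.subst σ)
  | disj φ ψ, σ => disj (φ.subst σ) (ψ.subst σ)
  | imp φ ψ, σ => imp (φ.subst σ) (ψ.subst σ)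
  | all φ, σ => all (φ.subst (up σ))
  | ex φ, σ => ex (φ.subst (up σ))

/-- Rename every free variable `n` to `n + 1`, so that the variable `0` becomes fresh. -/
def shift (φ : Formula) : Formula := φ.subst fun n => Tm.v (n + 1)

/-- The substitution that sends the variable `0` to `t` and `n + 1` to `n`. -/
def instSub (t : Tm) : ℕ → Tm
  | 0 => t
  | n + 1 => Tm.v n

/-- The substitution that sends the variable `0` to its successor and fixes the others. -/
def succSub : ℕ → Tm
  | 0 => Tm.succ (Tm.v 0)
  | n + 1 => Tm.v (n + 1)

/-- The instance `φ(t)` of `∀ x φ(x)` or `∃ x φ(x)`, where `x` is the variable `0` of `φ`. -/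
def inst (φ : Formula) (t : Tm) : Formula := φ.subst (instSub t)

end Formula

open Formula

/-! ## Intuitionistic predicate logic, `HA` and `PA` -/

/-- Intuitionistic natural deduction: `Derives T Γ φ` means that `φ` is derivable from the axioms
`T` and the open assumptions `Γ`.  Free variables of an axiom are read as universally quantified,
so the eigenvariable conditions concern `Γ` only. -/
inductive Derives (T : Set Formula) : List Formula → Formula → Prop
  | ax {Γ φ} : φ ∈ T → Derives T Γ φ
  | hyp {Γ φ} : φ ∈ Γ → Derives T Γ φ
  | falsumE {Γ φ} : Derives T Γ falsum → Derives T Γ φ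
  | andI {Γ φ ψ} : Derives T Γ φ → Derives T Γ ψ → Derives T Γ (conj φ ψ)
  | andE₁ {Γ φ ψ} : Derives T Γ (conj φ ψ) → Derives T Γ φ
  | andE₂ {Γ φ ψ} : Derives T Γ (conj φ ψ) → Derives T Γ ψ
  | orI₁ {Γ φ ψ} : Derives T Γ φ → Derives T Γ (disj φ ψ)
  | orI₂ {Γ φ ψ} : Derives T Γ ψ → Derives T Γ (disj φ ψ)
  | orE {Γ φ ψ χ} : Derives T Γ (disj φ ψ) → Derives T (φ :: Γ) χ → Derives T (ψ :: Γ) χ →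
      Derives T Γ χ
  | impI {Γ φ ψ} : Derives T (φ :: Γ) ψ → Derives T Γ (imp φ ψ)
  | impE {Γ φ ψ} : Derives T Γ (imp φ ψ) → Derives T Γ φ → Derives T Γ ψ
  | allI {Γ φ} : Derives T (Γ.map shift) φ → Derives T Γ (all φ)
  | allE {Γ φ} (t : Tm) : Derives T Γ (all φ) → Derives T Γ (φ.inst t)
  | exI {Γ φ} (t : Tm) : Derives T Γ (φ.inst t) → Derives T Γ (ex φ)
  | exE {Γ φ ψ} : Derives T Γ (ex φ) → Derives T (φ :: Γ.map shift) ψ.shift → Derives T Γ ψ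

/-- `T ⊢ φ`. -/
def Proves (T : Set Formula) (φ : Formula) : Prop := Derives T [] φ

/-- `T'` is an extension of `T`: every theorem of `T` is a theorem of `T'`. -/
def Extends (T' T : Set Formula) : Prop := ∀ φ, Proves T φ → Proves T' φ

/-- `T ⊢ P` for a scheme `P`: every instance of `P` is provable in `T`. -/
def ProvesScheme (T P : Set Formula) : Prop := ∀ φ ∈ P, Proves T φ

/-- The axioms of intuitionistic (Heyting) arithmetic: equality, successor, the defining equations
of all primitive recursive function symbols, and induction for all formulas. -/
inductive HA : Set Formula
  | eqRefl (t : Tm) : HA (eq t t)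
  | eqSubst (φ : Formula) (s t : Tm) : HA (imp (eq s t) (imp (φ.inst s) (φ.inst t)))
  | succNeZero (t : Tm) : HA (neg (eq (Tm.succ t) Tm.zero))
  | succInj (s t : Tm) : HA (imp (eq (Tm.succ s) (Tm.succ t)) (eq s t))
  | projDef {n : ℕ} (i : Fin n) (ts : Fin n → Tm) : HA (eq (Tm.app (PRSym.proj i) ts) (ts i))
  | compDef {m n : ℕ} (f : PRSym m) (g : Fin m → PRSym n) (ts : Fin n → Tm) :
      HA (eq (Tm.app (PRSym.comp f g) ts) (Tm.app f fun i => Tm.app (g i) ts))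
  | precZero {n : ℕ} (f : PRSym n) (g : PRSym (n + 2)) (ts : Fin n → Tm) :
      HA (eq (Tm.app (PRSym.prec f g) (Fin.cons Tm.zero ts)) (Tm.app f ts))
  | precSucc {n : ℕ} (f : PRSym n) (g : PRSym (n + 2)) (y : Tm) (ts : Fin n → Tm) :
      HA (eq (Tm.app (PRSym.prec f g) (Fin.cons (Tm.succ y) ts))
        (Tm.app g (Fin.cons y (Fin.cons (Tm.app (PRSym.prec f g) (Fin.cons y ts)) ts))))
  | induction (φ : Formula) :
      HA (imp (conj (φ.inst Tm.zero) (all (imp φ (φ.subst succSub)))) (all φ))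

/-- Classical (Peano) arithmetic: `HA` together with the law of excluded middle for all formulas. -/
def PA : Set Formula := HA ∪ {χ | ∃ φ : Formula, χ = disj φ (neg φ)}

/-! ## The classes `Σ_k` and `Π_k` -/

/-- `∀ x₁ … ∀ xₙ φ`. -/
def alls : ℕ → Formula → Formula
  | 0, φ => φ
  | n + 1, φ => all (alls n φ)

/-- `∃ x₁ … ∃ xₙ φ`. -/
def exs : ℕ → Formula → Formula
  | 0, φ => φ
  | n + 1, φ => ex (exs n φ)

mutual

/-- `Σ_k` : `k` alternating non-empty blocks of quantifiers, the first one existential, in front of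
a quantifier-free formula. -/
def SigmaClass : ℕ → Set Formula
  | 0 => {φ | φ.QF}
  | k + 1 => {φ | ∃ n, ∃ ψ ∈ PiClass k, φ = exs (n + 1) ψ}

/-- `Π_k` : `k` alternating non-empty blocks of quantifiers, the first one universal, in front of
a quantifier-free formula. -/
def PiClass : ℕ → Set Formula
  | 0 => {φ | φ.QF}
  | k + 1 => {φ | ∃ n, ∃ ψ ∈ SigmaClass k, φ = alls (n + 1) ψ}

end

/-! ## Alternation paths and the classes `F_k` and `U_k` -/

/-- The symbols `+` and `-`. -/
inductive Sign : Type
  | plus : Sign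
  | minus : Sign
  deriving DecidableEq

/-- Switching `+` and `-`. -/
def Sign.flip : Sign → Sign
  | plus => minus
  | minus => plus

/-- `s ↦ s^⊥`. -/
def dual (s : List Sign) : List Sign := s.map Sign.flip

/-- `s` itself if `s` begins with `a`, and `a s` otherwise. -/
def extend (a : Sign) (s : List Sign) : List Sign := if s.head? = some a then s else a :: s

/-- The set of alternation paths of a formula.  See `altPaths_of_QF` for quantifier-free formulas. -/
def altPaths : Formula → Finset (List Sign)
  | falsum => {[]}
  | eq _ _ => {[]}
  | conj φ ψ => altPaths φ ∪ altPaths ψ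
  | disj φ ψ => altPaths φ ∪ altPaths ψ
  | imp φ falsum => (altPaths φ).image dual
  | imp φ ψ => (altPaths φ).image dual ∪ altPaths ψ
  | all φ => (altPaths φ).image (extend Sign.minus)
  | ex φ => (altPaths φ).image (extend Sign.plus)

/-- A quantifier-free formula has the empty alternation path only. -/
theorem altPaths_of_QF (φ : Formula) (h : φ.QF) : altPaths φ = {[]} := by
  induction φ with
  | falsum => rfl
  | eq s t => rfl
  | conj φ ψ h₁ h₂ => simp [altPaths, h₁ h.1, h₂ h.2]
  | disj φ ψ h₁ h₂ => simp [altPaths, h₁ h.1, h₂ h.2]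
  | imp φ ψ h₁ h₂ =>
    have h₂ := h₂ h.2
    cases ψ <;> simp_all [altPaths, QF, dual]
  | all φ _ => exact h.elim
  | ex φ _ => exact h.elim

/-- The degree of a formula: the maximal length of its alternation paths. -/
def degree (φ : Formula) : ℕ := (altPaths φ).sup List.length

/-- `F_k`. -/
def FClass (k : ℕ) : Set Formula := {φ | degree φ = k}

/-- `U_k`. -/
def UClass : ℕ → Set Formula
  | 0 => FClass 0
  | k + 1 => {φ | φ ∈ FClass (k + 1) ∧
      ∀ s ∈ altPaths φ, s.length = k + 1 → s.head? = some Sign.minus}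

/-! ## The logical principle and the prenex normal form statement -/

/-- The scheme `(Γ ∨ Γ')-DNE`: `∀ x (¬¬(φ(x) ∨ ψ(x)) → φ(x) ∨ ψ(x))` for `φ(x)` in `Γ` and `ψ(x)` in
`Γ'` without free variables other than `x`. -/
def OrDNE (Γ Γ' : Set Formula) : Set Formula :=
  {χ | ∃ φ ∈ Γ, ∃ ψ ∈ Γ', φ.fv ⊆ {0} ∧ ψ.fv ⊆ {0} ∧
    χ = all (imp (neg (neg (disj φ ψ))) (disj φ ψ))}

/-- `PNFT_T(Γ, Γ')`: every formula in `Γ` is `T`-provably equivalent to a formula in `Γ'` with the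
same free variables. -/
def PNFT (T Γ Γ' : Set Formula) : Prop :=
  ∀ φ ∈ Γ, ∃ φ' ∈ Γ', φ.fv = φ'.fv ∧ Proves T (φ.iff φ')

end SemiClassical

namespace SemiClassical

open Formula

/-! ## Substitution -/

namespace Tm

-- The scheme allows one free variable, but a primitive recursive pairing verified in `HA` codes any
-- list of parameters into one number, so the scheme makes disjunctions of arbitrary `Π_k` formulas
-- stable (`DisjStable`).
--
-- From the scheme to prenex forms: `DisjStable` at `j + 2` turns excluded middle at level `j` into
-- excluded middle at level `j + 1`. For `φ` in `Σ_{j+1}`, `¬φ` is equivalent to a `Π_{j+1}`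
-- formula, so `φ ∨ ¬φ` is a disjunction of formulas equivalent to `Π_{j+2}` ones, and its double
-- negation is provable. Hence `DisjStable` at `k + 1` yields `LEM` at `k` (`DisjStable.lem`), and
-- with it prenex forms for everything up to level `k` (`LEM.prenex`). At level `k + 1` one proves
-- simultaneously that formulas of `U`-type are `Π_{k+1}` and that formulas of the dual type have
-- `Π_{k+1}` negations; stability of disjunctions replaces the missing excluded middle
-- (`DisjStable.prenex`).
--
-- From prenex forms to the scheme: by induction on the level one derives `LEM` at `k` from prenex
-- forms up to `k + 1`. For `φ` in `Σ_{k+1}`, `φ ∨ ¬φ` is equivalent to a `U_{k+2}` formula, hence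
-- to a `Π_{k+2}` formula, which `PA` proves. Given `LEM` at `k`, `PA` is `Π_{k+2}`-conservative
-- over `T` (`LEM.conservative`), by Friedman's trick: in a negative translation, `⊥` is replaced by
-- the existential formula to be proved. Finally, `LEM` at `k` makes `Π_{k+1}` formulas stable, and
-- a disjunction of two of them is equivalent to one of them.

theorem subst_subst (t : Tm) (σ τ : ℕ → Tm) :
    (t.subst σ).subst τ = t.subst fun n => (σ n).subst τ := by
  induction t with
  | var n => rfl
  | func f ts ih => simp [FirstOrder.Language.Term.subst, ih]

theorem relabel_eq_subst (t : Tm) (f : ℕ → ℕ) :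
    (t.relabel f : Tm) = t.subst fun n => v (f n) := by
  induction t with
  | var n => rfl
  | func g ts ih => simp [FirstOrder.Language.Term.subst, FirstOrder.Language.Term.relabel, ih]

theorem subst_v (t : Tm) : t.subst v = t := by
  induction t with
  | var n => rfl
  | func f ts ih => simp [FirstOrder.Language.Term.subst, ih]

theorem subst_congr {t : Tm} {σ τ : ℕ → Tm} (h : ∀ n ∈ t.varFinset, σ n = τ n) :
    t.subst σ = t.subst τ := by
  induction t with
  | var n => exact h n (by simp [FirstOrder.Language.Term.varFinset])
  | func f ts ih =>
    simp only [FirstOrder.Language.Term.subst]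
    congr 1
    funext i
    refine ih i fun n hn => h n ?_
    simp only [FirstOrder.Language.Term.varFinset, Finset.mem_biUnion, Finset.mem_univ, true_and]
    exact ⟨i, hn⟩

theorem mem_varFinset_subst {t : Tm} {σ : ℕ → Tm} {m : ℕ} :
    m ∈ (t.subst σ).varFinset ↔ ∃ n ∈ t.varFinset, m ∈ (σ n).varFinset := by
  induction t with
  | var n => simp [FirstOrder.Language.Term.varFinset, FirstOrder.Language.Term.subst]
  | func f ts ih =>
    simp only [FirstOrder.Language.Term.subst, FirstOrder.Language.Term.varFinset,
      Finset.mem_biUnion, Finset.mem_univ, true_and, ih]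
    exact ⟨fun ⟨i, n, hn, hm⟩ => ⟨n, ⟨i, hn⟩, hm⟩, fun ⟨n, ⟨i, hn⟩, hm⟩ => ⟨i, n, hn, hm⟩⟩

@[simp] theorem subst_var (n : ℕ) (σ : ℕ → Tm) : (v n).subst σ = σ n := rfl

@[simp] theorem varFinset_v (n : ℕ) : (v n).varFinset = {n} := rfl

theorem subst_app {n : ℕ} (f : PRSym n) (ts : Fin n → Tm) (σ : ℕ → Tm) :
    (app f ts).subst σ = app f fun i => (ts i).subst σ := rfl

@[simp] theorem subst_zero (σ : ℕ → Tm) : zero.subst σ = zero := by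
  rw [zero, subst_app]
  congr 1
  exact Subsingleton.elim _ _

@[simp] theorem subst_app_one (f : PRSym 1) (t : Tm) (σ : ℕ → Tm) :
    (app f ![t]).subst σ = app f ![t.subst σ] := by
  rw [subst_app]
  congr 1
  funext i
  fin_cases i
  rfl

@[simp] theorem subst_app_two (f : PRSym 2) (s t : Tm) (σ : ℕ → Tm) :
    (app f ![s, t]).subst σ = app f ![s.subst σ, t.subst σ] := by
  rw [subst_app]
  congr 1
  funext i
  fin_cases i <;> rfl

@[simp] theorem subst_succ (t : Tm) (σ : ℕ → Tm) : (succ t).subst σ = succ (t.subst σ) :=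
  subst_app_one _ _ _

end Tm

namespace Formula

theorem up_zero (σ : ℕ → Tm) : up σ 0 = Tm.v 0 := rfl

theorem up_succ (σ : ℕ → Tm) (n : ℕ) :
    up σ (n + 1) = (σ n).subst fun m => Tm.v (m + 1) := Tm.relabel_eq_subst _ _

theorem up_comp (σ τ : ℕ → Tm) :
    (fun n => (up σ n).subst (up τ)) = up fun n => (σ n).subst τ := by
  funext n
  cases n with
  | zero => rfl
  | succ n => simp [up_succ, Tm.subst_subst]

theorem up_v : up Tm.v = Tm.v := by
  funext n
  cases n <;> rfl

theorem subst_subst (φ : Formula) (σ τ : ℕ → Tm) :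
    (φ.subst σ).subst τ = φ.subst fun n => (σ n).subst τ := by
  induction φ generalizing σ τ with
  | falsum => rfl
  | eq s t => simp [subst, Tm.subst_subst]
  | conj φ ψ h₁ h₂ => simp [subst, h₁, h₂]
  | disj φ ψ h₁ h₂ => simp [subst, h₁, h₂]
  | imp φ ψ h₁ h₂ => simp [subst, h₁, h₂]
  | all φ h => simp [subst, h, up_comp]
  | ex φ h => simp [subst, h, up_comp]

theorem subst_v (φ : Formula) : φ.subst Tm.v = φ := by
  induction φ with
  | falsum => rfl
  | eq s t => simp [subst, Tm.subst_v]
  | conj φ ψ h₁ h₂ => simp [subst, h₁, h₂]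
  | disj φ ψ h₁ h₂ => simp [subst, h₁, h₂]
  | imp φ ψ h₁ h₂ => simp [subst, h₁, h₂]
  | all φ h => simp [subst, h, up_v]
  | ex φ h => simp [subst, h, up_v]

theorem up_congr {s : Set ℕ} {σ τ : ℕ → Tm} (h : ∀ n, n + 1 ∈ s → σ n = τ n) :
    ∀ n ∈ s, up σ n = up τ n := by
  intro n hn
  cases n with
  | zero => rfl
  | succ n => rw [up_succ, up_succ, h n hn]

theorem subst_congr {φ : Formula} {σ τ : ℕ → Tm} (h : ∀ n ∈ φ.fv, σ n = τ n) :
    φ.subst σ = φ.subst τ := by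
  induction φ generalizing σ τ with
  | falsum => rfl
  | eq s t =>
    simp only [subst]
    rw [Tm.subst_congr fun n hn => h n (Or.inl hn), Tm.subst_congr fun n hn => h n (Or.inr hn)]
  | conj φ ψ h₁ h₂ =>
    simp only [subst]
    rw [h₁ fun n hn => h n (Or.inl hn), h₂ fun n hn => h n (Or.inr hn)]
  | disj φ ψ h₁ h₂ =>
    simp only [subst]
    rw [h₁ fun n hn => h n (Or.inl hn), h₂ fun n hn => h n (Or.inr hn)]
  | imp φ ψ h₁ h₂ =>
    simp only [subst]
    rw [h₁ fun n hn => h n (Or.inl hn), h₂ fun n hn => h n (Or.inr hn)]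
  | all φ ih =>
    simp only [subst]
    rw [ih (up_congr h)]
  | ex φ ih =>
    simp only [subst]
    rw [ih (up_congr h)]

theorem exists_mem_up_iff {s : Set ℕ} {σ : ℕ → Tm} {m : ℕ} :
    (∃ n ∈ s, m + 1 ∈ (up σ n).varFinset) ↔ ∃ n, n + 1 ∈ s ∧ m ∈ (σ n).varFinset := by
  constructor
  · rintro ⟨n, hn, hm⟩
    cases n with
    | zero => simp [up_zero] at hm
    | succ n =>
      rw [up_succ, Tm.mem_varFinset_subst] at hm
      obtain ⟨i, hi, hm⟩ := hm
      simp only [Tm.varFinset_v, Finset.mem_singleton, Nat.add_right_cancel_iff] at hm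
      exact ⟨n, hn, hm ▸ hi⟩
  · rintro ⟨n, hn, hm⟩
    refine ⟨n + 1, hn, ?_⟩
    rw [up_succ, Tm.mem_varFinset_subst]
    exact ⟨m, hm, by simp⟩

theorem mem_fv_subst {φ : Formula} {σ : ℕ → Tm} {m : ℕ} :
    m ∈ (φ.subst σ).fv ↔ ∃ n ∈ φ.fv, m ∈ (σ n).varFinset := by
  induction φ generalizing σ m with
  | falsum => simp [subst, fv]
  | eq s t =>
    simp only [subst, fv, Set.mem_union, Finset.mem_coe, Tm.mem_varFinset_subst, or_and_right,
      exists_or]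
  | conj φ ψ h₁ h₂ => simp only [subst, fv, Set.mem_union, h₁, h₂, or_and_right, exists_or]
  | disj φ ψ h₁ h₂ => simp only [subst, fv, Set.mem_union, h₁, h₂, or_and_right, exists_or]
  | imp φ ψ h₁ h₂ => simp only [subst, fv, Set.mem_union, h₁, h₂, or_and_right, exists_or]
  | all φ ih => simp only [subst, fv, Set.mem_ofPred_eq, ih, exists_mem_up_iff]
  | ex φ ih => simp only [subst, fv, Set.mem_ofPred_eq, ih, exists_mem_up_iff]

theorem exists_fv_lt (φ : Formula) : ∃ N, ∀ n ∈ φ.fv, n < N := by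
  have union : ∀ {a b : Set ℕ}, (∃ N, ∀ n ∈ a, n < N) → (∃ N, ∀ n ∈ b, n < N) →
      ∃ N, ∀ n ∈ a ∪ b, n < N := fun ⟨M, hM⟩ ⟨N, hN⟩ => ⟨max M N, fun n hn =>
        hn.elim (fun h => lt_max_of_lt_left (hM n h)) fun h => lt_max_of_lt_right (hN n h)⟩
  have fin : ∀ s : Finset ℕ, ∃ N, ∀ n ∈ (s : Set ℕ), n < N := fun s =>
    ⟨s.sup id + 1, fun n hn => Nat.lt_succ_of_le (Finset.le_sup (f := id) hn)⟩
  have pre : ∀ {a : Set ℕ}, (∃ N, ∀ n ∈ a, n < N) → ∃ N, ∀ n ∈ {n | n + 1 ∈ a}, n < N :=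
    fun ⟨N, hN⟩ => ⟨N, fun n hn => (Nat.lt_succ_self n).trans (hN _ hn)⟩
  induction φ with
  | falsum => exact ⟨0, fun n hn => hn.elim⟩
  | eq s t => exact union (fin _) (fin _)
  | conj φ ψ h₁ h₂ => exact union h₁ h₂
  | disj φ ψ h₁ h₂ => exact union h₁ h₂
  | imp φ ψ h₁ h₂ => exact union h₁ h₂
  | all φ h => exact pre h
  | ex φ h => exact pre h

theorem mem_fv_shift {φ : Formula} {m : ℕ} : m + 1 ∈ φ.shift.fv ↔ m ∈ φ.fv := by
  rw [shift, mem_fv_subst]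
  simp

theorem shift_inst (φ : Formula) (t : Tm) : φ.shift.inst t = φ := by
  rw [shift, inst, subst_subst]
  exact subst_v φ

theorem subst_up_shift_inst (φ : Formula) :
    (φ.subst (up fun n => Tm.v (n + 1))).inst (Tm.v 0) = φ := by
  rw [inst, subst_subst]
  convert subst_v φ using 2
  funext n
  cases n <;> rfl

theorem shift_subst (φ : Formula) (σ : ℕ → Tm) : (φ.subst σ).shift = φ.shift.subst (up σ) := by
  rw [shift, shift, subst_subst, subst_subst]
  congr 1
  funext n
  rw [Tm.subst_var, up_succ]

end Formula

/-! ## Natural deduction -/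

namespace Derives

variable {T : Set Formula} {Γ Δ : List Formula} {φ ψ χ : Formula}

theorem mono (h : Derives T Γ φ) (hΓ : Γ ⊆ Δ) : Derives T Δ φ := by
  induction h generalizing Δ with
  | ax h => exact ax h
  | hyp h => exact hyp (hΓ h)
  | falsumE _ ih => exact falsumE (ih hΓ)
  | andI _ _ ih₁ ih₂ => exact andI (ih₁ hΓ) (ih₂ hΓ)
  | andE₁ _ ih => exact andE₁ (ih hΓ)
  | andE₂ _ ih => exact andE₂ (ih hΓ)
  | orI₁ _ ih => exact orI₁ (ih hΓ)
  | orI₂ _ ih => exact orI₂ (ih hΓ)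
  | orE _ _ _ ih ih₁ ih₂ =>
    exact orE (ih hΓ) (ih₁ (List.cons_subset_cons _ hΓ)) (ih₂ (List.cons_subset_cons _ hΓ))
  | impI _ ih => exact impI (ih (List.cons_subset_cons _ hΓ))
  | impE _ _ ih₁ ih₂ => exact impE (ih₁ hΓ) (ih₂ hΓ)
  | allI _ ih => exact allI (ih (List.map_subset _ hΓ))
  | allE t _ ih => exact allE t (ih hΓ)
  | exI t _ ih => exact exI t (ih hΓ)
  | exE _ _ ih₁ ih₂ =>
    exact exE (ih₁ hΓ) (ih₂ (List.cons_subset_cons _ (List.map_subset _ hΓ)))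

theorem wk (h : Derives T Γ φ) : Derives T (ψ :: Γ) φ := h.mono (List.subset_cons_self _ _)

theorem hyp0 : Derives T (φ :: Γ) φ := hyp (by simp)

theorem hyp1 : Derives T (ψ :: φ :: Γ) φ := hyp (by simp)

theorem hyp2 : Derives T (χ :: ψ :: φ :: Γ) φ := hyp (by simp)

/-- Eliminating a shifted universal formula at the fresh variable. -/
theorem allE_shift (h : Derives T Γ (all φ).shift) : Derives T Γ φ := by
  have := allE (Tm.v 0) h
  rwa [subst_up_shift_inst] at this

/-- Introducing a shifted existential formula with the fresh variable as witness. -/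
theorem exI_shift (h : Derives T Γ φ) : Derives T Γ (ex φ).shift := by
  refine exI (Tm.v 0) ?_
  rwa [subst_up_shift_inst]

end Derives

namespace Proves

variable {T : Set Formula} {φ ψ χ : Formula}

theorem wk (h : Proves T φ) {Γ : List Formula} : Derives T Γ φ := h.mono (List.nil_subset _)

theorem all (h : Proves T φ) : Proves T (all φ) := Derives.allI h

/-- The set `T` need not be closed under substitution, so variables are generalized and instantiated
one at a time. Each instantiation lowers the remaining indices, whence the `n - N`. -/
theorem substAux (N : ℕ) (σ : ℕ → Tm) (h : Proves T φ) :
    Proves T (φ.subst fun n => if n < N then σ n else Tm.v (n - N)) := by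
  induction N generalizing φ σ with
  | zero =>
    simp only [Nat.not_lt_zero, if_false, Nat.sub_zero]
    exact (subst_v φ).symm ▸ h
  | succ N ih =>
    -- The inserted term is raised by `N` to compensate for the `N` instantiations still to come.
    have := ih (fun n => σ (n + 1)) (h.all.allE ((σ 0).subst fun n => Tm.v (n + N)))
    rw [inst, subst_subst] at this
    convert this using 2
    funext n
    cases n with
    | zero =>
      simp only [Nat.zero_lt_succ, if_true, instSub, Tm.subst_subst, Tm.subst_var]
      simp only [Nat.not_lt.2 (Nat.le_add_left _ _), if_false, Nat.add_sub_cancel]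
      exact (Tm.subst_v _).symm
    | succ n => simp [instSub]

/-- Theorems are closed under substitution. -/
theorem subst (h : Proves T φ) (σ : ℕ → Tm) : Proves T (φ.subst σ) := by
  obtain ⟨N, hN⟩ := exists_fv_lt φ
  have := h.substAux N σ
  rwa [subst_congr (τ := σ) fun n hn => if_pos (hN n hn)] at this

theorem of_all (h : Proves T (Formula.all φ)) : Proves T φ :=
  Derives.allE_shift (h.subst fun n => Tm.v (n + 1))

theorem mp (h : Proves T (imp φ ψ)) (h' : Proves T φ) : Proves T ψ := Derives.impE h h'

end Proves

/-! ## Equality in `HA` -/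

theorem Tm.shift_inst (s t : Tm) :
    (s.subst fun n => Tm.v (n + 1)).subst (instSub t) = s := by
  rw [Tm.subst_subst]
  exact Tm.subst_v s

namespace Derives

variable {Γ : List Formula} {φ ψ : Formula} {r s t : Tm}

theorem eq_refl (t : Tm) : Derives HA Γ (eq t t) := ax (HA.eqRefl t)

theorem eq_inst (φ : Formula) (h : Derives HA Γ (eq s t)) (h' : Derives HA Γ (φ.inst s)) :
    Derives HA Γ (φ.inst t) := ((ax (HA.eqSubst φ s t)).impE h).impE h'

theorem eq_congr (u : Tm) (h : Derives HA Γ (eq s t)) :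
    Derives HA Γ (eq (u.subst (instSub s)) (u.subst (instSub t))) := by
  have := eq_inst (eq ((u.subst (instSub s)).subst fun n => Tm.v (n + 1)) u) h
  simp only [inst, subst, Tm.shift_inst] at this
  exact this (eq_refl _)

theorem eq_symm (h : Derives HA Γ (eq s t)) : Derives HA Γ (eq t s) := by
  have := eq_inst (eq (Tm.v 0) (s.subst fun n => Tm.v (n + 1))) h
  simp only [inst, subst, Tm.shift_inst] at this
  exact this (eq_refl _)

theorem eq_trans (h : Derives HA Γ (eq r s)) (h' : Derives HA Γ (eq s t)) :
    Derives HA Γ (eq r t) := by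
  have := eq_inst (eq (r.subst fun n => Tm.v (n + 1)) (Tm.v 0)) h'
  simp only [inst, subst, Tm.shift_inst] at this
  exact this h

theorem eq_app {n : ℕ} (f : PRSym n) (ts us : Fin n → Tm)
    (h : ∀ i, Derives HA Γ (eq (ts i) (us i))) :
    Derives HA Γ (eq (Tm.app f ts) (Tm.app f us)) := by
  -- The Leibniz axiom replaces one term at a time; here the first `j` arguments have been replaced.
  have key : ∀ j ≤ n, Derives HA Γ
      (eq (Tm.app f ts) (Tm.app f fun i => if i.val < j then us i else ts i)) := by
    intro j
    induction j with
    | zero => exact fun _ => eq_refl _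
    | succ j ih =>
      intro hj
      refine eq_trans (ih (by omega)) ?_
      have := eq_congr (Tm.app f fun i => if i.val = j then Tm.v 0 else
        ((if i.val < j then us i else ts i).subst fun n => Tm.v (n + 1))) (h ⟨j, hj⟩)
      rw [Tm.subst_app, Tm.subst_app] at this
      have hs : ∀ u, (fun i : Fin n => (if i.val = j then Tm.v 0 else
          ((if i.val < j then us i else ts i).subst fun n => Tm.v (n + 1))).subst (instSub u)) =
          fun i => if i.val = j then u else if i.val < j then us i else ts i := by
        intro u
        funext i
        split_ifs <;> first | rfl | exact Tm.shift_inst _ _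
      rw [hs, hs] at this
      convert this using 3
      all_goals
        funext i
        rcases lt_trichotomy i.val j with hi | hi | hi
        · simp [hi, hi.ne, hi.trans (Nat.lt_succ_self j)]
        · obtain rfl : i = ⟨j, hj⟩ := Fin.ext hi
          simp
        · simp [hi.ne', Nat.not_lt.2 hi.le, Nat.not_lt.2 (Nat.succ_le_of_lt hi)]
  have := key n le_rfl
  simpa using this

theorem eq_app_one (f : PRSym 1) (h : Derives HA Γ (eq s t)) :
    Derives HA Γ (eq (Tm.app f ![s]) (Tm.app f ![t])) :=
  eq_app f _ _ fun i => by fin_cases i; exact h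

theorem eq_app_two (f : PRSym 2) {s' t' : Tm} (h : Derives HA Γ (eq s t))
    (h' : Derives HA Γ (eq s' t')) :
    Derives HA Γ (eq (Tm.app f ![s, s']) (Tm.app f ![t, t'])) :=
  eq_app f _ _ fun i => by fin_cases i <;> [exact h; exact h']

theorem eq_succ (h : Derives HA Γ (eq s t)) : Derives HA Γ (eq s.succ t.succ) := eq_app_one _ h

theorem eq_subst_congr (t : Tm) {σ τ : ℕ → Tm}
    (h : ∀ n ∈ t.varFinset, Derives HA Γ (eq (σ n) (τ n))) :
    Derives HA Γ (eq (t.subst σ) (t.subst τ)) := by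
  induction t with
  | var n => exact h n (by simp [FirstOrder.Language.Term.varFinset])
  | func f ts ih =>
    refine eq_app f _ _ fun i => ih i fun n hn => h n ?_
    simp only [FirstOrder.Language.Term.varFinset, Finset.mem_biUnion, Finset.mem_univ, true_and]
    exact ⟨i, hn⟩

/-- The induction rule. -/
theorem induct (φ : Formula) (h₀ : Derives HA Γ (φ.inst Tm.zero))
    (h₁ : Derives HA (φ :: Γ.map shift) (φ.subst succSub)) : Derives HA Γ (Formula.all φ) :=
  (ax (HA.induction φ)).impE (h₀.andI h₁.impI.allI)

end Derives

open Derives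

/-! ## Congruence of provable equivalence -/

namespace Proves

variable {T : Set Formula} {φ ψ χ φ' ψ' : Formula}

theorem iff_refl (φ : Formula) : Proves T (φ.iff φ) := andI (impI hyp0) (impI hyp0)

theorem iff_symm (h : Proves T (φ.iff ψ)) : Proves T (ψ.iff φ) := andI (andE₂ h) (andE₁ h)

theorem iff_mp (h : Proves T (φ.iff ψ)) {Γ : List Formula} (h' : Derives T Γ φ) :
    Derives T Γ ψ := (andE₁ h.wk).impE h'

theorem iff_mpr (h : Proves T (φ.iff ψ)) {Γ : List Formula} (h' : Derives T Γ ψ) :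
    Derives T Γ φ := (andE₂ h.wk).impE h'

theorem iff_trans (h : Proves T (φ.iff ψ)) (h' : Proves T (ψ.iff χ)) : Proves T (φ.iff χ) :=
  andI (impI (h'.iff_mp (h.iff_mp hyp0))) (impI (h.iff_mpr (h'.iff_mpr hyp0)))

theorem iff_conj (h : Proves T (φ.iff φ')) (h' : Proves T (ψ.iff ψ')) :
    Proves T ((conj φ ψ).iff (conj φ' ψ')) :=
  andI (impI (andI (h.iff_mp (andE₁ hyp0)) (h'.iff_mp (andE₂ hyp0))))
    (impI (andI (h.iff_mpr (andE₁ hyp0)) (h'.iff_mpr (andE₂ hyp0))))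

theorem iff_disj (h : Proves T (φ.iff φ')) (h' : Proves T (ψ.iff ψ')) :
    Proves T ((disj φ ψ).iff (disj φ' ψ')) :=
  andI (impI (orE hyp0 (orI₁ (h.iff_mp hyp0)) (orI₂ (h'.iff_mp hyp0))))
    (impI (orE hyp0 (orI₁ (h.iff_mpr hyp0)) (orI₂ (h'.iff_mpr hyp0))))

theorem iff_imp (h : Proves T (φ.iff φ')) (h' : Proves T (ψ.iff ψ')) :
    Proves T ((imp φ ψ).iff (imp φ' ψ')) :=
  andI (impI (impI (h'.iff_mp (impE hyp1 (h.iff_mpr hyp0)))))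
    (impI (impI (h'.iff_mpr (impE hyp1 (h.iff_mp hyp0)))))

theorem iff_all (h : Proves T (φ.iff φ')) : Proves T ((Formula.all φ).iff (Formula.all φ')) :=
  andI (impI (allI (h.iff_mp (allE_shift hyp0)))) (impI (allI (h.iff_mpr (allE_shift hyp0))))

theorem iff_ex (h : Proves T (φ.iff φ')) : Proves T ((ex φ).iff (ex φ')) :=
  andI (impI (exE hyp0 (exI_shift (h.iff_mp hyp0)))) (impI (exE hyp0 (exI_shift (h.iff_mpr hyp0))))

/-- The equations are proved without open assumptions, so they may be renamed when passing under a
quantifier. -/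
theorem eq_up {s : Set ℕ} {σ τ : ℕ → Tm} (h : ∀ n, n + 1 ∈ s → Proves HA (eq (σ n) (τ n))) :
    ∀ n ∈ s, Proves HA (eq (up σ n) (up τ n)) := by
  intro n hn
  cases n with
  | zero => exact eq_refl _
  | succ n =>
    rw [up_succ, up_succ]
    exact (h n hn).subst _

/-- Provably equal substitutions give provably equivalent instances. -/
theorem iff_subst_congr (φ : Formula) {σ τ : ℕ → Tm}
    (h : ∀ n ∈ φ.fv, Proves HA (eq (σ n) (τ n))) : Proves HA ((φ.subst σ).iff (φ.subst τ)) := by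
  induction φ generalizing σ τ with
  | falsum => exact iff_refl _
  | eq s t =>
    have hs : Proves HA _ := eq_subst_congr s fun n hn => h n (Or.inl hn)
    have ht : Proves HA _ := eq_subst_congr t fun n hn => h n (Or.inr hn)
    exact andI (impI (eq_trans (eq_symm hs.wk) (eq_trans hyp0 ht.wk)))
      (impI (eq_trans hs.wk (eq_trans hyp0 (eq_symm ht.wk))))
  | conj φ ψ h₁ h₂ =>
    exact iff_conj (h₁ fun n hn => h n (Or.inl hn)) (h₂ fun n hn => h n (Or.inr hn))
  | disj φ ψ h₁ h₂ =>
    exact iff_disj (h₁ fun n hn => h n (Or.inl hn)) (h₂ fun n hn => h n (Or.inr hn))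
  | imp φ ψ h₁ h₂ =>
    exact iff_imp (h₁ fun n hn => h n (Or.inl hn)) (h₂ fun n hn => h n (Or.inr hn))
  | all φ ih => exact iff_all (ih (eq_up h))
  | ex φ ih => exact iff_ex (ih (eq_up h))

end Proves

/-! ## A pairing function in `HA` -/

namespace PRSym

/-- Addition, by recursion on the first argument. -/
def add : PRSym 2 := prec (proj 0) (comp succ ![proj 1])

/-- Predecessor. -/
def pred : PRSym 1 := prec zero (proj 0)

/-- Truncated subtraction `y ∸ x` of the first argument `x` from the second argument `y`. -/
def rsub : PRSym 2 := prec (proj 0) (comp pred ![proj 1])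

/-- `1` at `0`, and `0` at successors. -/
def isZero : PRSym 1 := prec (comp succ ![zero]) (comp zero ![])

/-- Triangular numbers. -/
def tri : PRSym 1 := prec zero (comp succ ![comp add ![proj 1, proj 0]])

/-- The index of the largest triangular number that is at most the argument. -/
def root : PRSym 1 := prec zero
  (comp add ![comp isZero ![comp rsub ![comp succ ![proj 0], comp tri ![comp succ ![proj 1]]]],
    proj 1])

end PRSym

namespace Tm

/-- The term `s + t`. -/
def add (s t : Tm) : Tm := app PRSym.add ![s, t]

/-- The term for the predecessor of `t`. -/
def pred (t : Tm) : Tm := app PRSym.pred ![t]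

/-- The term `t ∸ s`. -/
def rsub (s t : Tm) : Tm := app PRSym.rsub ![s, t]

/-- The term that is `1` if `t` is `0`, and `0` otherwise. -/
def isZero (t : Tm) : Tm := app PRSym.isZero ![t]

/-- The triangular number with index `t`. -/
def tri (t : Tm) : Tm := app PRSym.tri ![t]

/-- The index of the largest triangular number that is at most `t`. -/
def root (t : Tm) : Tm := app PRSym.root ![t]

variable (s t : Tm) (σ : ℕ → Tm)

@[simp] theorem subst_add : (add s t).subst σ = add (s.subst σ) (t.subst σ) := subst_app_two _ _ _ _

@[simp] theorem subst_rsub : (rsub s t).subst σ = rsub (s.subst σ) (t.subst σ) :=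
  subst_app_two _ _ _ _

@[simp] theorem subst_tri : (tri t).subst σ = tri (t.subst σ) := subst_app_one _ _ _

@[simp] theorem subst_root : (root t).subst σ = root (t.subst σ) := subst_app_one _ _ _

end Tm

namespace Derives

variable {Γ : List Formula} (r s t : Tm)

theorem eq_comp_one {m : ℕ} (f : PRSym 1) (g : PRSym m) (ts : Fin m → Tm) {u : Tm}
    (h : Derives HA Γ (eq (Tm.app g ts) u)) :
    Derives HA Γ (eq (Tm.app (PRSym.comp f ![g]) ts) (Tm.app f ![u])) :=
  (ax (HA.compDef f ![g] ts)).eq_trans (eq_app f _ _ fun i => by fin_cases i; exact h)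

theorem eq_comp_two {m : ℕ} (f : PRSym 2) (g g' : PRSym m) (ts : Fin m → Tm) {u u' : Tm}
    (h : Derives HA Γ (eq (Tm.app g ts) u)) (h' : Derives HA Γ (eq (Tm.app g' ts) u')) :
    Derives HA Γ (eq (Tm.app (PRSym.comp f ![g, g']) ts) (Tm.app f ![u, u'])) :=
  (ax (HA.compDef f ![g, g'] ts)).eq_trans
    (eq_app f _ _ fun i => by fin_cases i <;> [exact h; exact h'])

theorem eq_proj {m : ℕ} (i : Fin m) (ts : Fin m → Tm) :
    Derives HA Γ (eq (Tm.app (PRSym.proj i) ts) (ts i)) := ax (HA.projDef i ts)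

theorem zero_add : Derives HA Γ (eq (Tm.add Tm.zero t) t) :=
  (ax (HA.precZero _ _ ![t])).eq_trans (eq_proj 0 _)

theorem succ_add : Derives HA Γ (eq (Tm.add s.succ t) (Tm.add s t).succ) :=
  (ax (HA.precSucc _ _ s ![t])).eq_trans (eq_comp_one _ _ _ (eq_proj 1 _))

theorem pred_succ : Derives HA Γ (eq (Tm.pred t.succ) t) := by
  have h := ax (T := HA) (Γ := Γ) (HA.precSucc PRSym.zero (PRSym.proj 0) t ![])
  exact h.eq_trans (eq_proj 0 _)

theorem zero_rsub : Derives HA Γ (eq (Tm.rsub Tm.zero t) t) :=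
  (ax (HA.precZero _ _ ![t])).eq_trans (eq_proj 0 _)

theorem succ_rsub : Derives HA Γ (eq (Tm.rsub s.succ t) (Tm.rsub s t).pred) :=
  (ax (HA.precSucc _ _ s ![t])).eq_trans (eq_comp_one _ _ _ (eq_proj 1 _))

theorem eq_zero_sym (ts : Fin 0 → Tm) : Derives HA Γ (eq (Tm.app PRSym.zero ts) Tm.zero) :=
  eq_app _ _ _ fun i => i.elim0

theorem isZero_zero : Derives HA Γ (eq (Tm.isZero Tm.zero) Tm.zero.succ) := by
  have h := ax (T := HA) (Γ := Γ)
    (HA.precZero (PRSym.comp PRSym.succ ![PRSym.zero]) (PRSym.comp PRSym.zero ![]) ![])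
  exact h.eq_trans (eq_comp_one _ _ _ (eq_zero_sym _))

theorem isZero_succ : Derives HA Γ (eq (Tm.isZero t.succ) Tm.zero) := by
  have h := ax (T := HA) (Γ := Γ)
    (HA.precSucc (PRSym.comp PRSym.succ ![PRSym.zero]) (PRSym.comp PRSym.zero ![]) t ![])
  exact h.eq_trans ((ax (HA.compDef _ _ _)).eq_trans (eq_zero_sym _))

theorem tri_zero : Derives HA Γ (eq (Tm.tri Tm.zero) Tm.zero) := by
  have h := ax (T := HA) (Γ := Γ) (HA.precZero PRSym.zero
    (PRSym.comp PRSym.succ ![PRSym.comp PRSym.add ![PRSym.proj 1, PRSym.proj 0]]) ![])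
  exact h.eq_trans (eq_zero_sym _)

theorem tri_succ : Derives HA Γ (eq (Tm.tri t.succ) (Tm.add (Tm.tri t) t).succ) := by
  have h := ax (T := HA) (Γ := Γ) (HA.precSucc PRSym.zero
    (PRSym.comp PRSym.succ ![PRSym.comp PRSym.add ![PRSym.proj 1, PRSym.proj 0]]) t ![])
  exact h.eq_trans (eq_comp_one _ _ _ (eq_comp_two _ _ _ _ (eq_proj 1 _) (eq_proj 0 _)))

theorem root_zero : Derives HA Γ (eq (Tm.root Tm.zero) Tm.zero) :=
  (ax (HA.precZero _ _ ![])).eq_trans (eq_zero_sym _)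

/-- The truncated difference vanishes exactly when `t + 1` has reached the next triangular number,
so `isZero` adds one at the start of each block and nothing elsewhere. -/
theorem root_succ : Derives HA Γ (eq (Tm.root t.succ)
    (Tm.add (Tm.isZero (Tm.rsub t.succ (Tm.tri (Tm.root t).succ))) (Tm.root t))) :=
  (ax (HA.precSucc _ _ t ![])).eq_trans (eq_comp_two _ _ _ _ (eq_comp_one _ _ _
    (eq_comp_two _ _ _ _ (eq_comp_one _ _ _ (eq_proj 0 _))
      (eq_comp_one _ _ _ (eq_comp_one _ _ _ (eq_proj 1 _))))) (eq_proj 1 _))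

variable {r s t} {s' t' : Tm}

theorem eq_add (h : Derives HA Γ (eq s t)) (h' : Derives HA Γ (eq s' t')) :
    Derives HA Γ (eq (s.add s') (t.add t')) := eq_app_two _ h h'

theorem eq_rsub (h : Derives HA Γ (eq s t)) (h' : Derives HA Γ (eq s' t')) :
    Derives HA Γ (eq (s.rsub s') (t.rsub t')) := eq_app_two _ h h'

theorem eq_pred (h : Derives HA Γ (eq s t)) : Derives HA Γ (eq s.pred t.pred) := eq_app_one _ h

theorem eq_isZero (h : Derives HA Γ (eq s t)) : Derives HA Γ (eq s.isZero t.isZero) :=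
  eq_app_one _ h

theorem eq_tri (h : Derives HA Γ (eq s t)) : Derives HA Γ (eq s.tri t.tri) := eq_app_one _ h

theorem eq_root (h : Derives HA Γ (eq s t)) : Derives HA Γ (eq s.root t.root) := eq_app_one _ h

end Derives

/-- Substitution for the first three variables. -/
def sub₃ (r s t : Tm) : ℕ → Tm
  | 0 => r
  | 1 => s
  | 2 => t
  | n => Tm.v n

namespace Derives

variable {Γ : List Formula} (r s t : Tm)

theorem add_zero : Derives HA Γ (eq (Tm.add t Tm.zero) t) := by
  have h : Proves HA (Formula.all (eq (Tm.add (Tm.v 0) Tm.zero) (Tm.v 0))) := by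
    refine induct _ ?_ ?_
    · simp only [inst, subst, instSub, Tm.subst_add, Tm.subst_zero, Tm.subst_var]
      exact zero_add _
    · simp only [subst, succSub, Tm.subst_add, Tm.subst_zero, Tm.subst_var]
      exact (succ_add _ _).eq_trans hyp0.eq_succ
  simpa [subst, sub₃] using (h.of_all.subst (sub₃ t t t)).wk (Γ := Γ)

theorem add_succ : Derives HA Γ (eq (Tm.add s t.succ) (Tm.add s t).succ) := by
  have h : Proves HA (Formula.all (eq (Tm.add (Tm.v 0) (Tm.v 1).succ)
      (Tm.add (Tm.v 0) (Tm.v 1)).succ)) := by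
    refine induct _ ?_ ?_
    · simp only [inst, subst, instSub, Tm.subst_add, Tm.subst_succ, Tm.subst_var]
      exact (zero_add _).eq_trans (zero_add _).eq_symm.eq_succ
    · simp only [subst, succSub, Tm.subst_add, Tm.subst_succ, Tm.subst_var]
      exact (succ_add _ _).eq_trans (hyp0.eq_trans (succ_add _ _).eq_symm).eq_succ
  simpa [subst, sub₃] using (h.of_all.subst (sub₃ s t t)).wk (Γ := Γ)

theorem add_assoc : Derives HA Γ (eq (Tm.add (Tm.add r s) t) (Tm.add r (Tm.add s t))) := by
  have h : Proves HA (Formula.all (eq (Tm.add (Tm.add (Tm.v 0) (Tm.v 1)) (Tm.v 2))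
      (Tm.add (Tm.v 0) (Tm.add (Tm.v 1) (Tm.v 2))))) := by
    refine induct _ ?_ ?_
    · simp only [inst, subst, instSub, Tm.subst_add, Tm.subst_var]
      exact ((zero_add _).eq_add (eq_refl _)).eq_trans (zero_add _).eq_symm
    · simp only [subst, succSub, Tm.subst_add, Tm.subst_var]
      exact ((succ_add _ _).eq_add (eq_refl _)).eq_trans ((succ_add _ _).eq_trans
        (hyp0.eq_succ.eq_trans (succ_add _ _).eq_symm))
  simpa [subst, sub₃] using (h.of_all.subst (sub₃ r s t)).wk (Γ := Γ)

theorem rsub_add : Derives HA Γ (eq (Tm.rsub s (Tm.add s t)) t) := by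
  -- The induction is on the subtrahend with the other summand quantified, because the step rewrites
  -- `(s + 1) + t` as `s + (t + 1)`.
  have h : Proves HA (Formula.all (Formula.all
      (eq (Tm.rsub (Tm.v 1) (Tm.add (Tm.v 1) (Tm.v 0))) (Tm.v 0)))) := by
    refine induct _ ?_ ?_
    · simp only [inst, subst, instSub, Tm.subst_add, Tm.subst_rsub, Tm.subst_var, up_zero, up_succ,
        Tm.subst_zero]
      exact allI ((zero_rsub _).eq_trans (zero_add _))
    · simp only [subst, succSub, Tm.subst_add, Tm.subst_rsub, Tm.subst_succ, Tm.subst_var, up_zero,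
        up_succ]
      refine allI ((succ_rsub _ _).eq_trans ?_)
      refine eq_trans (eq_pred ?_) (pred_succ _)
      refine ((eq_refl _).eq_rsub ((succ_add _ _).eq_trans (add_succ _ _).eq_symm)).eq_trans ?_
      have := allE (Tm.v 0).succ (hyp0 (T := HA) (Γ := [])
        (φ := (Formula.all (eq (Tm.rsub (Tm.v 1) (Tm.add (Tm.v 1) (Tm.v 0))) (Tm.v 0))).shift))
      simpa [inst, subst, instSub, up_zero, up_succ, shift] using this
  simpa [subst, sub₃] using (h.of_all.of_all.subst (sub₃ t s t)).wk (Γ := Γ)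

theorem rsub_self : Derives HA Γ (eq (Tm.rsub t t) Tm.zero) :=
  ((eq_refl _).eq_rsub (add_zero _).eq_symm).eq_trans (rsub_add _ _)

variable {r s t}

/-- Inside a block, the index does not change. -/
theorem root_succ_of_lt (h : Derives HA Γ (eq (Tm.root (Tm.add (Tm.tri (Tm.add s t.succ)) s))
    (Tm.add s t.succ))) :
    Derives HA Γ (eq (Tm.root (Tm.add (Tm.tri (Tm.add s t.succ)) s.succ)) (Tm.add s t.succ)) := by
  refine (eq_root (add_succ _ _)).eq_trans ((root_succ _).eq_trans ?_)
  refine eq_trans (eq_add ?_ h) (zero_add _)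
  refine eq_trans (eq_isZero ?_) (isZero_succ t)
  refine eq_trans (eq_rsub (eq_refl _) (h.eq_succ.eq_tri.eq_trans ((tri_succ _).eq_trans ?_)))
    (rsub_add _ _)
  exact (add_assoc _ _ _).eq_symm.eq_succ.eq_trans (succ_add _ _).eq_symm

/-- At the end of a block, the index increases. -/
theorem root_succ_of_eq (h : Derives HA Γ (eq (Tm.root (Tm.add (Tm.tri t) t)) t)) :
    Derives HA Γ (eq (Tm.root (Tm.tri t.succ)) t.succ) := by
  refine (eq_root (tri_succ _)).eq_trans ((root_succ _).eq_trans ?_)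
  refine eq_trans (eq_add (s := _) (t := Tm.zero.succ) ?_ h)
    ((succ_add _ _).eq_trans (zero_add _).eq_succ)
  refine eq_trans (eq_isZero ?_) isZero_zero
  exact eq_trans (eq_rsub (eq_refl _) (h.eq_succ.eq_tri.eq_trans (tri_succ _))) (rsub_self _)

/-- Position `s` in the block with index `n` is described by `n = s + t`, which avoids the order
relation. The induction moves along a fixed block: `t` is quantified so that position `s + 1` with
remainder `t` follows from position `s` with remainder `t + 1`. -/
theorem root_tri_add_of_root_tri (h : Derives HA Γ (eq (Tm.root (Tm.tri (Tm.add s t)))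
    (Tm.add s t))) : Derives HA Γ (eq (Tm.root (Tm.add (Tm.tri (Tm.add s t)) s)) (Tm.add s t)) := by
  let θ : Formula := Formula.all (imp (eq (Tm.root (Tm.tri (Tm.add (Tm.v 1) (Tm.v 0))))
    (Tm.add (Tm.v 1) (Tm.v 0))) (eq (Tm.root (Tm.add (Tm.tri (Tm.add (Tm.v 1) (Tm.v 0))) (Tm.v 1)))
      (Tm.add (Tm.v 1) (Tm.v 0))))
  have hθ : Proves HA (Formula.all θ) := by
    refine induct _ ?_ ?_
    · simp only [θ, inst, subst, instSub, Tm.subst_add, Tm.subst_root, Tm.subst_tri, Tm.subst_var,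
        up_zero, up_succ, Tm.subst_zero]
      exact allI (impI ((add_zero _).eq_root.eq_trans hyp0))
    · simp only [θ, subst, succSub, Tm.subst_add, Tm.subst_root, Tm.subst_tri, Tm.subst_succ,
        Tm.subst_var, up_zero, up_succ]
      refine allI (impI ?_)
      have e : ∀ {Γ}, Derives HA Γ (eq (Tm.add (Tm.v 1).succ (Tm.v 0))
          (Tm.add (Tm.v 1) (Tm.v 0).succ)) := (succ_add _ _).eq_trans (add_succ _ _).eq_symm
      have := allE (Tm.v 0).succ (hyp0 (T := HA) (Γ := []) (φ := θ.shift))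
      simp only [θ, inst, subst, instSub, up_zero, up_succ, shift, Tm.subst_add, Tm.subst_root,
        Tm.subst_tri, Tm.subst_var] at this
      refine (eq_add e.eq_tri (eq_refl _)).eq_root.eq_trans
        (eq_trans (root_succ_of_lt ?_) e.eq_symm)
      refine impE (this.mono ?_) (e.eq_symm.eq_tri.eq_root.eq_trans (hyp0.eq_trans e))
      simp [shift, subst, up_zero, up_succ, Tm.v]
  have := (hθ.of_all.of_all.subst (sub₃ t s s)).wk (Γ := Γ)
  simp only [subst, sub₃, Tm.subst_add, Tm.subst_root, Tm.subst_tri, Tm.subst_var] at this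
  exact this.impE h

theorem root_tri (t : Tm) : Derives HA Γ (eq (Tm.root (Tm.tri t)) t) := by
  have h : Proves HA (Formula.all (eq (Tm.root (Tm.tri (Tm.v 0))) (Tm.v 0))) := by
    refine induct _ ?_ ?_
    · simp only [inst, subst, instSub, Tm.subst_root, Tm.subst_tri, Tm.subst_var]
      exact tri_zero.eq_root.eq_trans root_zero
    · simp only [subst, succSub, Tm.subst_root, Tm.subst_tri, Tm.subst_var]
      refine root_succ_of_eq ?_
      -- The last position of block `t` is the case of remainder `0`; from there the index jumps to
      -- `t + 1`.
      have e := add_zero (Γ := [eq (Tm.root (Tm.tri (Tm.v 0))) (Tm.v 0)]) (Tm.v 0)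
      have := root_tri_add_of_root_tri (e.eq_tri.eq_root.eq_trans (hyp0.eq_trans e.eq_symm))
      exact (eq_add e.eq_tri (eq_refl _)).eq_symm.eq_root.eq_trans (this.eq_trans e)
  simpa [subst, sub₃] using (h.of_all.subst (sub₃ t t t)).wk (Γ := Γ)

end Derives

namespace Tm

/-- The pairing function `⟨s, t⟩ ↦ (t + s) (t + s + 1) / 2 + t`. -/
def pair (s t : Tm) : Tm := add (tri (add t s)) t

/-- The second component of a pair. -/
def snd (t : Tm) : Tm := rsub (tri (root t)) t

/-- The first component of a pair. -/
def fst (t : Tm) : Tm := rsub (snd t) (root t)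

theorem subst_snd (t : Tm) (σ : ℕ → Tm) : (snd t).subst σ = snd (t.subst σ) := by simp [snd]

theorem subst_fst (t : Tm) (σ : ℕ → Tm) : (fst t).subst σ = fst (t.subst σ) := by
  simp [fst, subst_snd]

/-- The component with index `n` of a coded finite sequence. -/
def nth : ℕ → Tm → Tm
  | 0, t => fst t
  | n + 1, t => nth n (snd t)

/-- The code of the sequence of the variables `i, …, i + n - 1`. -/
def tuple : ℕ → ℕ → Tm
  | _, 0 => zero
  | i, n + 1 => pair (v i) (tuple (i + 1) n)

theorem subst_nth (n : ℕ) (t : Tm) (σ : ℕ → Tm) : (nth n t).subst σ = nth n (t.subst σ) := by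
  induction n generalizing t with
  | zero => exact subst_fst t σ
  | succ n ih => rw [nth, nth, ih, subst_snd]

end Tm

namespace Derives

variable {Γ : List Formula}

theorem snd_pair (s t : Tm) : Derives HA Γ (eq (Tm.snd (Tm.pair s t)) t) :=
  (eq_rsub (root_tri_add_of_root_tri (root_tri _)).eq_tri (eq_refl _)).eq_trans (rsub_add _ _)

theorem fst_pair (s t : Tm) : Derives HA Γ (eq (Tm.fst (Tm.pair s t)) s) :=
  (eq_rsub (snd_pair _ _) (root_tri_add_of_root_tri (root_tri _))).eq_trans (rsub_add _ _)

theorem eq_snd {s t : Tm} (h : Derives HA Γ (eq s t)) : Derives HA Γ (eq s.snd t.snd) :=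
  eq_rsub h.eq_root.eq_tri h

theorem eq_nth {s t : Tm} (n : ℕ) (h : Derives HA Γ (eq s t)) :
    Derives HA Γ (eq (s.nth n) (t.nth n)) := by
  induction n generalizing s t with
  | zero => exact eq_rsub h.eq_snd h.eq_root
  | succ n ih => exact ih h.eq_snd

theorem nth_tuple {i n m : ℕ} (h : i < n) :
    Derives HA Γ (eq ((Tm.tuple m n).nth i) (Tm.v (m + i))) := by
  induction i generalizing n m with
  | zero =>
    obtain ⟨n, rfl⟩ := Nat.exists_eq_succ_of_ne_zero h.ne'
    exact fst_pair _ _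
  | succ i ih =>
    obtain ⟨n, rfl⟩ := Nat.exists_eq_succ_of_ne_zero (Nat.ne_zero_of_lt h)
    have := ih (m := m + 1) (Nat.lt_of_succ_lt_succ h)
    rw [show m + 1 + i = m + (i + 1) by omega] at this
    exact (eq_nth i (snd_pair _ _)).eq_trans this

end Derives

/-! ## Decidability of quantifier-free formulas -/

namespace Derives

variable {T : Set Formula} {Γ : List Formula} {φ ψ : Formula}

/-- Case distinction on a decidable formula. -/
theorem cases (h : Proves T (disj φ φ.neg)) (h₁ : Derives T (φ :: Γ) ψ)
    (h₂ : Derives T (φ.neg :: Γ) ψ) : Derives T Γ ψ := orE h.wk h₁ h₂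

/-- Proof by contradiction for a stable formula. -/
theorem byContra (h : Proves T (imp φ.neg.neg φ)) (h' : Derives T (φ.neg :: Γ) falsum) :
    Derives T Γ φ := h.wk.impE (impI h')

end Derives

namespace Proves

variable {T : Set Formula} {φ ψ : Formula}

theorem dec_falsum : Proves T (disj falsum falsum.neg) := orI₂ (impI hyp0)

theorem dec_conj (h : Proves T (disj φ φ.neg)) (h' : Proves T (disj ψ ψ.neg)) :
    Proves T (disj (conj φ ψ) (conj φ ψ).neg) :=
  cases h (cases h' (orI₁ (andI hyp1 hyp0)) (orI₂ (impI (impE hyp1 (andE₂ hyp0)))))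
    (orI₂ (impI (impE hyp1 (andE₁ hyp0))))

theorem dec_disj (h : Proves T (disj φ φ.neg)) (h' : Proves T (disj ψ ψ.neg)) :
    Proves T (disj (disj φ ψ) (disj φ ψ).neg) :=
  cases h (orI₁ (orI₁ hyp0)) (cases h' (orI₁ (orI₂ hyp0))
    (orI₂ (impI (orE hyp0 (impE (hyp (by simp)) hyp0) (impE (hyp (by simp)) hyp0)))))

theorem dec_imp (h : Proves T (disj φ φ.neg)) (h' : Proves T (disj ψ ψ.neg)) :
    Proves T (disj (imp φ ψ) (imp φ ψ).neg) :=
  cases h (cases h' (orI₁ (impI hyp1)) (orI₂ (impI (impE hyp1 (impE hyp0 hyp2)))))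
    (orI₁ (impI (falsumE (impE hyp1 hyp0))))

theorem stable_of_dec (h : Proves T (disj φ φ.neg)) : Proves T (imp φ.neg.neg φ) :=
  impI (cases h hyp0 (falsumE (impE hyp1 hyp0)))

theorem dec_congr (h : Proves T (φ.iff ψ)) (h' : Proves T (disj φ φ.neg)) :
    Proves T (disj ψ ψ.neg) := (h.iff_disj (h.iff_imp (iff_refl _))).iff_mp h'

end Proves

open Tm in
theorem eq_dec_formula : Proves HA (Formula.all (Formula.all
    (disj (eq (v 1) (v 0)) (eq (v 1) (v 0)).neg))) := by
  have hz : Proves HA (Formula.all (disj (eq zero (v 0)) (eq zero (v 0)).neg)) := by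
    refine induct _ ?_ ?_
    · simp only [inst, subst, instSub, subst_zero, subst_var]
      exact orI₁ (eq_refl _)
    · simp only [subst, succSub, subst_zero, subst_var]
      exact orI₂ (impI (impE (ax (HA.succNeZero (v 0))) hyp0.eq_symm))
  refine induct _ ?_ ?_
  · change Proves HA _
    simpa [inst, subst, instSub, up_zero, up_succ, neg] using hz
  · simp only [subst, succSub, subst_succ, subst_var, up_zero, up_succ]
    -- This inner induction only distinguishes zero from successor; the successor case uses the
    -- outer hypothesis at the predecessor.
    refine induct _ ?_ ?_
    · simp only [inst, subst, instSub, subst_var, subst_succ]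
      exact orI₂ (impI (impE (ax (HA.succNeZero (v 0))) hyp0))
    · simp only [subst, succSub, subst_succ, subst_var]
      have := allE (v 0) (hyp1 (T := HA) (Γ := [])
        (ψ := disj (eq (v 1).succ (v 0)) (eq (v 1).succ (v 0)).neg)
        (φ := (Formula.all (disj (eq (v 1) (v 0)) (eq (v 1) (v 0)).neg)).shift))
      simp only [inst, subst, instSub, up_zero, up_succ, shift, subst_var] at this
      refine orE (this.mono (by simp [shift, subst, up_zero, up_succ])) (orI₁ hyp0.eq_succ)
        (orI₂ (impI (impE hyp1 (impE (ax (HA.succInj _ _)) hyp0))))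

theorem Proves.dec_eq (s t : Tm) : Proves HA (disj (eq s t) (eq s t).neg) := by
  simpa [Formula.subst, sub₃, neg] using eq_dec_formula.of_all.of_all.subst (sub₃ t s s)

theorem Proves.dec_of_QF {φ : Formula} (h : φ.QF) : Proves HA (disj φ φ.neg) := by
  induction φ with
  | falsum => exact dec_falsum
  | eq s t => exact dec_eq s t
  | conj φ ψ h₁ h₂ => exact dec_conj (h₁ h.1) (h₂ h.2)
  | disj φ ψ h₁ h₂ => exact dec_disj (h₁ h.1) (h₂ h.2)
  | imp φ ψ h₁ h₂ => exact dec_imp (h₁ h.1) (h₂ h.2)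
  | all φ _ => exact h.elim
  | ex φ _ => exact h.elim

/-! ## Provable equivalence with the same free variables -/

/-- Provable equivalence of formulas with the same free variables. -/
structure Eqv (T : Set Formula) (φ ψ : Formula) : Prop where
  fv : φ.fv = ψ.fv
  iff : Proves T (φ.iff ψ)

/-- The formula `φ` is provably equivalent to a formula in `C` with the same free variables. -/
def EqvIn (T : Set Formula) (φ : Formula) (C : Set Formula) : Prop := ∃ φ' ∈ C, Eqv T φ φ'

namespace Eqv

variable {T : Set Formula} {φ ψ χ φ' ψ' : Formula}

theorem refl (φ : Formula) : Eqv T φ φ := ⟨rfl, Proves.iff_refl φ⟩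

theorem symm (h : Eqv T φ ψ) : Eqv T ψ φ := ⟨h.fv.symm, h.iff.iff_symm⟩

theorem trans (h : Eqv T φ ψ) (h' : Eqv T ψ χ) : Eqv T φ χ :=
  ⟨h.fv.trans h'.fv, h.iff.iff_trans h'.iff⟩

theorem conj (h : Eqv T φ φ') (h' : Eqv T ψ ψ') : Eqv T (conj φ ψ) (conj φ' ψ') :=
  ⟨by rw [Formula.fv, Formula.fv, h.fv, h'.fv], h.iff.iff_conj h'.iff⟩

theorem disj (h : Eqv T φ φ') (h' : Eqv T ψ ψ') : Eqv T (disj φ ψ) (disj φ' ψ') :=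
  ⟨by rw [Formula.fv, Formula.fv, h.fv, h'.fv], h.iff.iff_disj h'.iff⟩

theorem imp (h : Eqv T φ φ') (h' : Eqv T ψ ψ') : Eqv T (imp φ ψ) (imp φ' ψ') :=
  ⟨by rw [Formula.fv, Formula.fv, h.fv, h'.fv], h.iff.iff_imp h'.iff⟩

theorem neg (h : Eqv T φ φ') : Eqv T φ.neg φ'.neg := h.imp (refl _)

theorem all (h : Eqv T φ φ') : Eqv T (all φ) (all φ') :=
  ⟨by rw [Formula.fv, Formula.fv, h.fv], h.iff.iff_all⟩

theorem ex (h : Eqv T φ φ') : Eqv T (ex φ) (ex φ') :=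
  ⟨by rw [Formula.fv, Formula.fv, h.fv], h.iff.iff_ex⟩

theorem alls (n : ℕ) (h : Eqv T φ φ') : Eqv T (alls n φ) (alls n φ') := by
  induction n with
  | zero => exact h
  | succ n ih => exact ih.all

theorem exs (n : ℕ) (h : Eqv T φ φ') : Eqv T (exs n φ) (exs n φ') := by
  induction n with
  | zero => exact h
  | succ n ih => exact ih.ex

theorem eqvIn {C : Set Formula} (h : Eqv T φ ψ) (hψ : EqvIn T ψ C) : EqvIn T φ C :=
  let ⟨χ, hχ, h'⟩ := hψ
  ⟨χ, hχ, h.trans h'⟩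

/-- Quantifier blocks are non-empty, so the prenex classes are cumulative only up to equivalence.
Vacuous quantifiers raise the level and keep the free variables. -/
theorem all_shift (φ : Formula) : Eqv T φ (Formula.all φ.shift) where
  fv := Set.ext fun _ => mem_fv_shift.symm
  iff := andI (impI (allI hyp0))
    (impI (by
      have := allE (Tm.v 0) (hyp0 (T := T) (Γ := []) (φ := Formula.all φ.shift))
      rwa [shift_inst] at this))

theorem ex_shift (φ : Formula) : Eqv T φ (Formula.ex φ.shift) where
  fv := Set.ext fun _ => mem_fv_shift.symm
  iff := andI (impI (exI (Tm.v 0) (by rw [shift_inst]; exact hyp0))) (impI (exE hyp0 hyp0))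

theorem conj_comm (φ ψ : Formula) : Eqv T (Formula.conj φ ψ) (Formula.conj ψ φ) where
  fv := Set.union_comm _ _
  iff := andI (impI (andI (andE₂ hyp0) (andE₁ hyp0))) (impI (andI (andE₂ hyp0) (andE₁ hyp0)))

theorem disj_comm (φ ψ : Formula) : Eqv T (Formula.disj φ ψ) (Formula.disj ψ φ) where
  fv := Set.union_comm _ _
  iff := andI (impI (orE hyp0 (orI₂ hyp0) (orI₁ hyp0))) (impI (orE hyp0 (orI₂ hyp0) (orI₁ hyp0)))

theorem fv_union_shift (φ ψ : Formula) :
    {n | n + 1 ∈ φ.fv} ∪ ψ.fv = {n | n + 1 ∈ φ.fv ∪ ψ.shift.fv} :=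
  Set.ext fun _ => or_congr Iff.rfl mem_fv_shift.symm

theorem conj_all (φ ψ : Formula) :
    Eqv T (Formula.conj (Formula.all φ) ψ) (Formula.all (Formula.conj φ ψ.shift)) where
  fv := fv_union_shift φ ψ
  iff := by
    refine andI (impI (allI (andI (allE_shift (andE₁ hyp0)) (andE₂ hyp0))))
      (impI (andI (allI (andE₁ (allE_shift hyp0))) ?_))
    have : Derives T [_] (ψ.shift.inst (Tm.v 0)) :=
      andE₂ (allE (Tm.v 0) (hyp0 (φ := Formula.all (Formula.conj φ ψ.shift))))
    rwa [shift_inst] at this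

theorem conj_ex (φ ψ : Formula) :
    Eqv T (Formula.conj (Formula.ex φ) ψ) (Formula.ex (Formula.conj φ ψ.shift)) where
  fv := fv_union_shift φ ψ
  iff := andI (impI (exE (andE₁ hyp0) (exI_shift (andI hyp0 (andE₂ hyp1)))))
    (impI (exE hyp0 (andI (exI_shift (andE₁ hyp0)) (andE₂ hyp0))))

theorem disj_ex (φ ψ : Formula) :
    Eqv T (Formula.disj (Formula.ex φ) ψ) (Formula.ex (Formula.disj φ ψ.shift)) where
  fv := fv_union_shift φ ψ
  iff := by
    refine andI (impI (orE hyp0 (exE hyp0 (exI_shift (orI₁ hyp0))) (exI (Tm.v 0) (orI₂ ?_))))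
      (impI (exE hyp0 (orE hyp0 (orI₁ (exI_shift hyp0)) (orI₂ hyp0))))
    change Derives T _ (ψ.shift.inst (Tm.v 0))
    rw [shift_inst]
    exact hyp0

/-- The direction from right to left is not intuitionistic. Stability of the target suffices: its
negation refutes `ψ`, and then every instance of the disjunction yields `φ`. -/
theorem disj_all (h : Proves T (Formula.imp (Formula.disj (Formula.all φ) ψ).neg.neg
    (Formula.disj (Formula.all φ) ψ))) :
    Eqv T (Formula.disj (Formula.all φ) ψ) (Formula.all (Formula.disj φ ψ.shift)) where
  fv := fv_union_shift φ ψ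
  iff := andI (impI (allI (orE hyp0 (orI₁ (allE_shift hyp0)) (orI₂ hyp0))))
    (impI (byContra h (impE hyp0 (orI₁ (allI (orE (allE_shift hyp1) hyp0
      (falsumE (impE hyp1 (orI₂ hyp0)))))))))

theorem neg_ex (φ : Formula) : Eqv T (Formula.ex φ).neg (Formula.all φ.neg) where
  fv := by ext; simp [Formula.fv]
  iff := andI (impI (allI (impI (impE hyp1 (exI_shift hyp0)))))
    (impI (impI (exE hyp0 (impE (allE_shift hyp2) hyp0))))

theorem neg_exs (n : ℕ) (φ : Formula) :
    Eqv T (SemiClassical.exs n φ).neg (SemiClassical.alls n φ.neg) := by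
  induction n with
  | zero => exact refl _
  | succ n ih => exact (neg_ex _).trans ih.all

theorem of_stable (h : Proves T (Formula.imp φ.neg.neg φ)) : Eqv T φ φ.neg.neg where
  fv := by simp [Formula.fv]
  iff := andI (impI (impI (impE hyp0 hyp1))) h

theorem neg_disj (φ ψ : Formula) :
    Eqv T (Formula.disj φ ψ).neg (Formula.conj φ.neg ψ.neg) where
  fv := by simp [Formula.fv]
  iff := andI (impI (andI (impI (impE hyp1 (orI₁ hyp0))) (impI (impE hyp1 (orI₂ hyp0)))))
    (impI (impI (orE hyp0 (impE (andE₁ hyp2) hyp0) (impE (andE₂ hyp2) hyp0))))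

/-- This De Morgan law and `imp_disj` need only the stability of the resulting disjunction, which is
what `DisjStable` supplies. -/
theorem neg_conj (h : Proves T (Formula.imp (Formula.disj φ.neg ψ.neg).neg.neg
    (Formula.disj φ.neg ψ.neg))) :
    Eqv T (Formula.conj φ ψ).neg (Formula.disj φ.neg ψ.neg) where
  fv := by simp [Formula.fv]
  iff := andI (impI (byContra h (impE hyp0 (orI₁ (impI (impE hyp1 (orI₂ (impI
      (impE (hyp (by simp)) (andI hyp1 hyp0))))))))))
    (impI (impI (orE hyp1 (impE hyp0 (andE₁ hyp1)) (impE hyp0 (andE₂ hyp1)))))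

theorem imp_disj (h : Proves T (Formula.imp (Formula.disj φ.neg ψ).neg.neg
    (Formula.disj φ.neg ψ))) :
    Eqv T (Formula.imp φ ψ) (Formula.disj φ.neg ψ) where
  fv := by simp [Formula.fv]
  iff := andI (impI (byContra h (impE hyp0 (orI₁ (impI (impE hyp1 (orI₂ (impE hyp2 hyp0))))))))
    (impI (impI (orE hyp1 (falsumE (impE hyp0 hyp1)) hyp0)))

theorem neg_imp (h : Proves T (Formula.imp φ.neg.neg φ)) :
    Eqv T (Formula.imp φ ψ).neg (Formula.conj φ ψ.neg) where
  fv := by simp [Formula.fv]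
  iff := andI
    (impI (andI (byContra h (impE hyp1 (impI (falsumE (impE hyp1 hyp0)))))
      (impI (impE hyp1 (impI hyp1)))))
    (impI (impI (impE (andE₂ hyp1) (impE hyp0 (andE₁ hyp1)))))

end Eqv

namespace Proves

variable {T : Set Formula} {φ ψ : Formula}

theorem stable_congr (h : Proves T (φ.iff ψ)) (h' : Proves T (imp φ.neg.neg φ)) :
    Proves T (imp ψ.neg.neg ψ) :=
  ((h.iff_imp (iff_refl _)).iff_imp (iff_refl _) |>.iff_imp h).iff_mp h'

theorem stable_neg (φ : Formula) : Proves T (imp φ.neg.neg.neg φ.neg) :=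
  impI (impI (impE hyp1 (impI (impE hyp0 hyp1))))

theorem not_not_lem (φ : Formula) : Proves T (disj φ φ.neg).neg.neg :=
  impI (impE hyp0 (orI₂ (impI (impE hyp1 (orI₁ hyp0)))))

end Proves

theorem EqvIn.of_mem {T C : Set Formula} {φ : Formula} (h : φ ∈ C) : EqvIn T φ C :=
  ⟨φ, h, Eqv.refl φ⟩

/-! ## The classes `Σ_k` and `Π_k` -/

theorem alls_subst (n : ℕ) (φ : Formula) (σ : ℕ → Tm) :
    (alls n φ).subst σ = alls n (φ.subst (up^[n] σ)) := by
  induction n generalizing σ with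
  | zero => rfl
  | succ n ih => exact congrArg all (ih _)

theorem exs_subst (n : ℕ) (φ : Formula) (σ : ℕ → Tm) :
    (exs n φ).subst σ = exs n (φ.subst (up^[n] σ)) := by
  induction n generalizing σ with
  | zero => rfl
  | succ n ih => exact congrArg ex (ih _)

theorem QF.subst {φ : Formula} (h : φ.QF) (σ : ℕ → Tm) : (φ.subst σ).QF := by
  induction φ with
  | falsum => trivial
  | eq s t => trivial
  | conj φ ψ h₁ h₂ => exact ⟨h₁ h.1, h₂ h.2⟩
  | disj φ ψ h₁ h₂ => exact ⟨h₁ h.1, h₂ h.2⟩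
  | imp φ ψ h₁ h₂ => exact ⟨h₁ h.1, h₂ h.2⟩
  | all φ _ => exact h.elim
  | ex φ _ => exact h.elim

theorem mem_sigma_zero {φ : Formula} : φ ∈ SigmaClass 0 ↔ φ.QF := by rw [SigmaClass]; rfl

theorem mem_pi_zero {φ : Formula} : φ ∈ PiClass 0 ↔ φ.QF := by rw [PiClass]; rfl

theorem mem_sigma_succ {j : ℕ} {φ : Formula} :
    φ ∈ SigmaClass (j + 1) ↔ ∃ n, ∃ ψ ∈ PiClass j, φ = exs (n + 1) ψ := by rw [SigmaClass]; rfl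

theorem mem_pi_succ {j : ℕ} {φ : Formula} :
    φ ∈ PiClass (j + 1) ↔ ∃ n, ∃ ψ ∈ SigmaClass j, φ = alls (n + 1) ψ := by rw [PiClass]; rfl

theorem exs_mem_sigma {j : ℕ} {φ : Formula} (n : ℕ) (h : φ ∈ PiClass j) :
    exs (n + 1) φ ∈ SigmaClass (j + 1) := mem_sigma_succ.2 ⟨n, φ, h, rfl⟩

theorem alls_mem_pi {j : ℕ} {φ : Formula} (n : ℕ) (h : φ ∈ SigmaClass j) :
    alls (n + 1) φ ∈ PiClass (j + 1) := mem_pi_succ.2 ⟨n, φ, h, rfl⟩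

theorem ex_mem_sigma {j : ℕ} {φ : Formula} (h : φ ∈ SigmaClass (j + 1)) :
    ex φ ∈ SigmaClass (j + 1) := by
  obtain ⟨n, ψ, hψ, rfl⟩ := mem_sigma_succ.1 h
  exact exs_mem_sigma (n + 1) hψ

theorem all_mem_pi {j : ℕ} {φ : Formula} (h : φ ∈ PiClass (j + 1)) :
    all φ ∈ PiClass (j + 1) := by
  obtain ⟨n, ψ, hψ, rfl⟩ := mem_pi_succ.1 h
  exact alls_mem_pi (n + 1) hψ

theorem sigma_pi_subst (j : ℕ) :
    (∀ φ ∈ SigmaClass j, ∀ σ, φ.subst σ ∈ SigmaClass j) ∧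
      ∀ φ ∈ PiClass j, ∀ σ, φ.subst σ ∈ PiClass j := by
  induction j with
  | zero =>
    exact ⟨fun φ h σ => mem_sigma_zero.2 (QF.subst (mem_sigma_zero.1 h) σ),
      fun φ h σ => mem_pi_zero.2 (QF.subst (mem_pi_zero.1 h) σ)⟩
  | succ j ih =>
    constructor
    · intro φ h σ
      obtain ⟨n, ψ, hψ, rfl⟩ := mem_sigma_succ.1 h
      rw [exs_subst]
      exact exs_mem_sigma n (ih.2 ψ hψ _)
    · intro φ h σ
      obtain ⟨n, ψ, hψ, rfl⟩ := mem_pi_succ.1 h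
      rw [alls_subst]
      exact alls_mem_pi n (ih.1 ψ hψ _)

theorem sigma_shift {j : ℕ} {φ : Formula} (h : φ ∈ SigmaClass j) : φ.shift ∈ SigmaClass j :=
  (sigma_pi_subst j).1 φ h _

theorem pi_shift {j : ℕ} {φ : Formula} (h : φ ∈ PiClass j) : φ.shift ∈ PiClass j :=
  (sigma_pi_subst j).2 φ h _

namespace EqvIn

variable {T : Set Formula} {φ ψ : Formula} {j : ℕ}

theorem sigma_of_pi (h : EqvIn T φ (PiClass j)) : EqvIn T φ (SigmaClass (j + 1)) :=
  let ⟨φ', h', e⟩ := h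
  ⟨ex φ'.shift, exs_mem_sigma 0 (pi_shift h'), e.trans (Eqv.ex_shift φ')⟩

theorem pi_of_sigma (h : EqvIn T φ (SigmaClass j)) : EqvIn T φ (PiClass (j + 1)) :=
  let ⟨φ', h', e⟩ := h
  ⟨all φ'.shift, alls_mem_pi 0 (sigma_shift h'), e.trans (Eqv.all_shift φ')⟩

theorem exs (n : ℕ) (h : EqvIn T φ (PiClass j)) :
    EqvIn T (exs (n + 1) φ) (SigmaClass (j + 1)) :=
  let ⟨_, h', e⟩ := h
  ⟨_, exs_mem_sigma n h', e.exs (n + 1)⟩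

theorem alls (n : ℕ) (h : EqvIn T φ (SigmaClass j)) :
    EqvIn T (alls (n + 1) φ) (PiClass (j + 1)) :=
  let ⟨_, h', e⟩ := h
  ⟨_, alls_mem_pi n h', e.alls (n + 1)⟩

theorem ex (h : EqvIn T φ (SigmaClass (j + 1))) : EqvIn T (ex φ) (SigmaClass (j + 1)) :=
  let ⟨_, h', e⟩ := h
  ⟨_, ex_mem_sigma h', e.ex⟩

theorem all (h : EqvIn T φ (PiClass (j + 1))) : EqvIn T (all φ) (PiClass (j + 1)) :=
  let ⟨_, h', e⟩ := h
  ⟨_, all_mem_pi h', e.all⟩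

theorem of_QF (h : φ.QF) (j : ℕ) : EqvIn T φ (SigmaClass j) ∧ EqvIn T φ (PiClass j) := by
  induction j with
  | zero => exact ⟨of_mem (mem_sigma_zero.2 h), of_mem (mem_pi_zero.2 h)⟩
  | succ j ih => exact ⟨ih.2.sigma_of_pi, ih.1.pi_of_sigma⟩

theorem succ (j : ℕ) : (∀ φ ∈ SigmaClass j, EqvIn T φ (SigmaClass (j + 1))) ∧
    ∀ φ ∈ PiClass j, EqvIn T φ (PiClass (j + 1)) := by
  induction j with
  | zero =>
    exact ⟨fun φ h => (of_QF (mem_sigma_zero.1 h) 1).1, fun φ h => (of_QF (mem_pi_zero.1 h) 1).2⟩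
  | succ j ih =>
    constructor
    · intro φ h
      obtain ⟨n, ψ, hψ, rfl⟩ := mem_sigma_succ.1 h
      exact (ih.2 ψ hψ).exs n
    · intro φ h
      obtain ⟨n, ψ, hψ, rfl⟩ := mem_pi_succ.1 h
      exact (ih.1 ψ hψ).alls n

end EqvIn

/-! ## The schemes with arbitrary parameters -/

/-- The law of excluded middle for `Σ_j` and `Π_j`. -/
def LEM (T : Set Formula) (j : ℕ) : Prop :=
  (∀ φ ∈ SigmaClass j, Proves T (disj φ φ.neg)) ∧ ∀ φ ∈ PiClass j, Proves T (disj φ φ.neg)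

/-- Stability of disjunctions of `Π_k` formulas, with arbitrary free variables. -/
def DisjStable (T : Set Formula) (k : ℕ) : Prop :=
  ∀ φ ∈ PiClass k, ∀ ψ ∈ PiClass k, Proves T (imp (disj φ ψ).neg.neg (disj φ ψ))

/-- All parameters are packed into one variable: variable `n` becomes the `n`-th component of `v 0`,
and the resulting instance of the scheme is specialized to the code of the tuple of the original
variables. -/
theorem disjStable_of_orDNE {T : Set Formula} (hT : Extends T HA) {k : ℕ}
    (h : ProvesScheme T (OrDNE (PiClass k) (PiClass k))) : DisjStable T k := by
  intro φ hφ ψ hψ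
  obtain ⟨N, hN⟩ := exists_fv_lt (disj φ ψ)
  let σ : ℕ → Tm := fun n => Tm.nth n (Tm.v 0)
  have hσ : ∀ χ : Formula, (χ.subst σ).fv ⊆ {0} := by
    intro χ m hm
    obtain ⟨n, -, hn⟩ := mem_fv_subst.1 hm
    simp only [σ] at hn
    -- Writing `v 0` as its own image under the constant substitution shows that `0` is the only
    -- possible variable of the component, whatever the term looks like.
    rw [← Tm.subst_var 0 (fun _ => Tm.v 0), ← Tm.subst_nth, Tm.mem_varFinset_subst] at hn
    obtain ⟨_, -, hm⟩ := hn
    exact Finset.mem_singleton.1 hm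
  have := Derives.allE (Tm.tuple 0 N) (h _ ⟨φ.subst σ, (sigma_pi_subst k).2 φ hφ σ, ψ.subst σ,
    (sigma_pi_subst k).2 ψ hψ σ, hσ φ, hσ ψ, rfl⟩)
  refine Proves.stable_congr (hT _ ?_) this
  change Proves HA ((((disj φ ψ).subst σ).inst (Tm.tuple 0 N)).iff (disj φ ψ))
  rw [inst, subst_subst]
  have := Proves.iff_subst_congr (disj φ ψ)
    (σ := fun n => (σ n).subst (instSub (Tm.tuple 0 N))) (τ := Tm.v) fun n hn => by
      simp only [σ, Tm.subst_nth]
      have := nth_tuple (Γ := []) (m := 0) (hN n hn)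
      rwa [Nat.zero_add] at this
  rwa [subst_v] at this

/-! ## Closure properties of the prenex classes -/

/-- Merging two blocks of quantifiers. -/
theorem merge_blocks {T : Set Formula} {Q : Formula → Formula} {Qs : ℕ → Formula → Formula}
    {op : Formula → Formula → Formula} {C : Set Formula}
    (hzero : ∀ φ, Qs 0 φ = φ) (hsucc : ∀ n φ, Qs (n + 1) φ = Q (Qs n φ))
    (hshift : ∀ n, ∀ φ ∈ C, ∃ φ' ∈ C, (Qs n φ).shift = Qs n φ')
    (hQ : ∀ φ ψ, Eqv T φ ψ → Eqv T (Q φ) (Q ψ)) (hcomm : ∀ φ ψ, Eqv T (op φ ψ) (op ψ φ))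
    (hC : ∀ φ ∈ C, ∀ ψ ∈ C, EqvIn T (op φ ψ) C)
    (hdistr : ∀ n, ∀ φ ∈ C, ∀ m, ∀ ψ ∈ C,
      Eqv T (op (Q (Qs n φ)) (Qs m ψ)) (Q (op (Qs n φ) (Qs m ψ).shift)))
    (n : ℕ) : ∀ φ ∈ C, ∀ m, ∀ ψ ∈ C, ∃ χ ∈ C, Eqv T (op (Qs n φ) (Qs m ψ)) (Qs (n + m) χ) := by
  induction n with
  | zero =>
    intro φ hφ m
    -- Once the left block is exhausted, commutativity brings the right block into the position
    -- where `hdistr` applies.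
    induction m generalizing φ with
    | zero => simpa only [hzero, EqvIn] using hC φ hφ
    | succ m ih =>
      intro ψ hψ
      obtain ⟨φ', hφ', e⟩ := hshift 0 φ hφ
      obtain ⟨χ, hχ, e'⟩ := ih φ' hφ' ψ hψ
      refine ⟨χ, hχ, ?_⟩
      rw [hsucc, ← Nat.add_assoc, hsucc]
      refine (hcomm _ _).trans ((hdistr m ψ hψ 0 φ hφ).trans (hQ _ _ ((hcomm _ _).trans ?_)))
      rwa [e]
  | succ n ih =>
    intro φ hφ m ψ hψ
    obtain ⟨ψ', hψ', e⟩ := hshift m ψ hψ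
    obtain ⟨χ, hχ, e'⟩ := ih φ hφ m ψ' hψ'
    refine ⟨χ, hχ, ?_⟩
    rw [hsucc, Nat.succ_add n m, hsucc]
    refine (hdistr n φ hφ m ψ hψ).trans (hQ _ _ ?_)
    rwa [e]

theorem alls_shift {j : ℕ} (n : ℕ) {φ : Formula} (h : φ ∈ SigmaClass j) :
    ∃ φ' ∈ SigmaClass j, (alls n φ).shift = alls n φ' :=
  ⟨_, (sigma_pi_subst j).1 φ h _, alls_subst n φ _⟩

theorem exs_shift {j : ℕ} (n : ℕ) {φ : Formula} (h : φ ∈ PiClass j) :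
    ∃ φ' ∈ PiClass j, (exs n φ).shift = exs n φ' :=
  ⟨_, (sigma_pi_subst j).2 φ h _, exs_subst n φ _⟩

theorem sigma_succ_closed {T : Set Formula} {j : ℕ} {op : Formula → Formula → Formula}
    (hop : ∀ φ ψ φ' ψ', Eqv T φ φ' → Eqv T ψ ψ' → Eqv T (op φ ψ) (op φ' ψ'))
    (hcomm : ∀ φ ψ, Eqv T (op φ ψ) (op ψ φ))
    (hdistr : ∀ φ ψ, Eqv T (op (ex φ) ψ) (ex (op φ ψ.shift)))
    (h : ∀ φ ψ, EqvIn T φ (PiClass j) → EqvIn T ψ (PiClass j) → EqvIn T (op φ ψ) (PiClass j))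
    (φ ψ : Formula) (hφ : EqvIn T φ (SigmaClass (j + 1))) (hψ : EqvIn T ψ (SigmaClass (j + 1))) :
    EqvIn T (op φ ψ) (SigmaClass (j + 1)) := by
  obtain ⟨φ, hφ, e⟩ := hφ
  obtain ⟨ψ, hψ, e'⟩ := hψ
  refine (hop _ _ _ _ e e').eqvIn ?_
  obtain ⟨n, φ, hφ', rfl⟩ := mem_sigma_succ.1 hφ
  obtain ⟨m, ψ, hψ', rfl⟩ := mem_sigma_succ.1 hψ
  obtain ⟨χ, hχ, e⟩ := merge_blocks (T := T) (Q := ex) (Qs := exs) (op := op) (C := PiClass j)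
    (fun _ => rfl) (fun _ _ => rfl) (fun n φ h => exs_shift n h) (fun _ _ => Eqv.ex) hcomm
    (fun φ hφ ψ hψ => h φ ψ (.of_mem hφ) (.of_mem hψ)) (fun _ _ _ _ _ _ => hdistr _ _)
    (n + 1) φ hφ' (m + 1) ψ hψ'
  exact ⟨_, exs_mem_sigma (n + 1 + m) hχ, e⟩

/-- Distributivity is demanded only for blocks over `Σ_j` formulas: for disjunctions it rests on
stability, which is not available for arbitrary formulas. -/
theorem pi_succ_closed {T : Set Formula} {j : ℕ} {op : Formula → Formula → Formula}
    (hop : ∀ φ ψ φ' ψ', Eqv T φ φ' → Eqv T ψ ψ' → Eqv T (op φ ψ) (op φ' ψ'))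
    (hcomm : ∀ φ ψ, Eqv T (op φ ψ) (op ψ φ))
    (hdistr : ∀ n, ∀ φ ∈ SigmaClass j, ∀ m, ∀ ψ ∈ SigmaClass j,
      Eqv T (op (all (alls n φ)) (alls m ψ)) (all (op (alls n φ) (alls m ψ).shift)))
    (h : ∀ φ ψ, EqvIn T φ (SigmaClass j) → EqvIn T ψ (SigmaClass j) →
      EqvIn T (op φ ψ) (SigmaClass j))
    (φ ψ : Formula) (hφ : EqvIn T φ (PiClass (j + 1))) (hψ : EqvIn T ψ (PiClass (j + 1))) :
    EqvIn T (op φ ψ) (PiClass (j + 1)) := by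
  obtain ⟨φ, hφ, e⟩ := hφ
  obtain ⟨ψ, hψ, e'⟩ := hψ
  refine (hop _ _ _ _ e e').eqvIn ?_
  obtain ⟨n, φ, hφ', rfl⟩ := mem_pi_succ.1 hφ
  obtain ⟨m, ψ, hψ', rfl⟩ := mem_pi_succ.1 hψ
  obtain ⟨χ, hχ, e⟩ := merge_blocks (T := T) (Q := all) (Qs := alls) (op := op)
    (C := SigmaClass j) (fun _ => rfl) (fun _ _ => rfl) (fun n φ h => alls_shift n h)
    (fun _ _ => Eqv.all) hcomm (fun φ hφ ψ hψ => h φ ψ (.of_mem hφ) (.of_mem hψ)) hdistr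
    (n + 1) φ hφ' (m + 1) ψ hψ'
  exact ⟨_, alls_mem_pi (n + 1 + m) hχ, e⟩

/-- The prenex classes are closed under conjunction. -/
theorem conj_closed {T : Set Formula} (j : ℕ) :
    (∀ φ ψ, EqvIn T φ (SigmaClass j) → EqvIn T ψ (SigmaClass j) →
      EqvIn T (conj φ ψ) (SigmaClass j)) ∧
    ∀ φ ψ, EqvIn T φ (PiClass j) → EqvIn T ψ (PiClass j) → EqvIn T (conj φ ψ) (PiClass j) := by
  induction j with
  | zero =>
    constructor
    · rintro φ ψ ⟨φ', hφ, e⟩ ⟨ψ', hψ, e'⟩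
      exact ⟨conj φ' ψ', mem_sigma_zero.2 ⟨mem_sigma_zero.1 hφ, mem_sigma_zero.1 hψ⟩, e.conj e'⟩
    · rintro φ ψ ⟨φ', hφ, e⟩ ⟨ψ', hψ, e'⟩
      exact ⟨conj φ' ψ', mem_pi_zero.2 ⟨mem_pi_zero.1 hφ, mem_pi_zero.1 hψ⟩, e.conj e'⟩
  | succ j ih =>
    exact ⟨sigma_succ_closed (fun _ _ _ _ => Eqv.conj) Eqv.conj_comm Eqv.conj_ex ih.2,
      pi_succ_closed (fun _ _ _ _ => Eqv.conj) Eqv.conj_comm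
        (fun _ _ _ _ _ _ => Eqv.conj_all _ _) ih.1⟩

theorem DisjStable.eqvIn {T : Set Formula} {k : ℕ} (h : DisjStable T k) {φ ψ : Formula}
    (hφ : EqvIn T φ (PiClass k)) (hψ : EqvIn T ψ (PiClass k)) :
    Proves T (imp (disj φ ψ).neg.neg (disj φ ψ)) := by
  obtain ⟨φ', hφ', e⟩ := hφ
  obtain ⟨ψ', hψ', e'⟩ := hψ
  exact Proves.stable_congr (e.disj e').symm.iff (h φ' hφ' ψ' hψ')

theorem DisjStable.pred {T : Set Formula} {k : ℕ} (h : DisjStable T (k + 1)) : DisjStable T k :=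
  fun φ hφ ψ hψ => h.eqvIn ((EqvIn.succ k).2 φ hφ) ((EqvIn.succ k).2 ψ hψ)

theorem DisjStable.of_le {T : Set Formula} {j k : ℕ} (h : DisjStable T k) (hj : j ≤ k) :
    DisjStable T j := by
  induction hj with
  | refl => exact h
  | step _ ih => exact ih h.pred

/-- Merging blocks passes through stages in which one block is empty; a vacuous quantifier then
fills it. -/
theorem EqvIn.alls_pi {T : Set Formula} {j : ℕ} {φ : Formula} (h : φ ∈ SigmaClass j) (n : ℕ) :
    EqvIn T (SemiClassical.alls n φ) (PiClass (j + 1)) := by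
  cases n with
  | zero => exact (EqvIn.of_mem h).pi_of_sigma
  | succ n => exact (EqvIn.of_mem h).alls n

/-- The prenex classes are closed under disjunction if disjunctions of `Π_j` formulas are stable. -/
theorem disj_closed {T : Set Formula} {j : ℕ} (h : DisjStable T j) :
    (∀ φ ψ, EqvIn T φ (SigmaClass j) → EqvIn T ψ (SigmaClass j) →
      EqvIn T (disj φ ψ) (SigmaClass j)) ∧
    ∀ φ ψ, EqvIn T φ (PiClass j) → EqvIn T ψ (PiClass j) → EqvIn T (disj φ ψ) (PiClass j) := by
  induction j with
  | zero =>
    constructor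
    · rintro φ ψ ⟨φ', hφ, e⟩ ⟨ψ', hψ, e'⟩
      exact ⟨disj φ' ψ', mem_sigma_zero.2 ⟨mem_sigma_zero.1 hφ, mem_sigma_zero.1 hψ⟩, e.disj e'⟩
    · rintro φ ψ ⟨φ', hφ, e⟩ ⟨ψ', hψ, e'⟩
      exact ⟨disj φ' ψ', mem_pi_zero.2 ⟨mem_pi_zero.1 hφ, mem_pi_zero.1 hψ⟩, e.disj e'⟩
  | succ j ih =>
    exact ⟨sigma_succ_closed (fun _ _ _ _ => Eqv.disj) Eqv.disj_comm Eqv.disj_ex (ih h.pred).2,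
      pi_succ_closed (fun _ _ _ _ => Eqv.disj) Eqv.disj_comm
        (fun n _ hφ m _ hψ => Eqv.disj_all
          (h.eqvIn (EqvIn.alls_pi hφ (n + 1)) (EqvIn.alls_pi hψ m))) (ih h.pred).1⟩

/-! ## Consequences of the law of excluded middle -/

theorem EqvIn.dec {T C : Set Formula} {φ : Formula}
    (hC : ∀ ψ ∈ C, Proves T (disj ψ ψ.neg)) (h : EqvIn T φ C) : Proves T (disj φ φ.neg) :=
  let ⟨ψ, hψ, e⟩ := h
  Proves.dec_congr e.symm.iff (hC ψ hψ)

namespace LEM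

variable {T : Set Formula} {j : ℕ} {φ ψ : Formula}

theorem zero (hT : Extends T HA) : LEM T 0 :=
  ⟨fun _ h => hT _ (Proves.dec_of_QF (mem_sigma_zero.1 h)),
    fun _ h => hT _ (Proves.dec_of_QF (mem_pi_zero.1 h))⟩

theorem pred (h : LEM T (j + 1)) : LEM T j :=
  ⟨fun _ hφ => (EqvIn.of_mem hφ).pi_of_sigma.dec h.2,
    fun _ hφ => (EqvIn.of_mem hφ).sigma_of_pi.dec h.1⟩

theorem disjStable (h : LEM T j) : DisjStable T j := fun φ hφ ψ hψ =>
  Proves.stable_of_dec (Proves.dec_disj (h.2 φ hφ) (h.2 ψ hψ))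

/-- A decidable matrix equals its double negation, and `∀¬` is `¬∃` intuitionistically. -/
theorem alls_eqv (n : ℕ) (h : Proves T (disj φ φ.neg)) :
    Eqv T (alls n φ) (exs n φ.neg).neg :=
  ((Eqv.of_stable (Proves.stable_of_dec h)).alls n).trans (Eqv.neg_exs n φ.neg).symm

theorem neg_form (h : LEM T j) : (∀ φ, EqvIn T φ (SigmaClass j) → EqvIn T φ.neg (PiClass j)) ∧
    ∀ φ, EqvIn T φ (PiClass j) → EqvIn T φ.neg (SigmaClass j) := by
  induction j with
  | zero =>
    constructor
    · rintro φ ⟨φ', hφ, e⟩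
      exact ⟨φ'.neg, mem_pi_zero.2 ⟨mem_sigma_zero.1 hφ, trivial⟩, e.neg⟩
    · rintro φ ⟨φ', hφ, e⟩
      exact ⟨φ'.neg, mem_sigma_zero.2 ⟨mem_pi_zero.1 hφ, trivial⟩, e.neg⟩
  | succ j ih =>
    constructor
    · rintro φ ⟨_, hφ, e⟩
      obtain ⟨n, θ, hθ, rfl⟩ := mem_sigma_succ.1 hφ
      exact (e.neg.trans (Eqv.neg_exs _ _)).eqvIn (((ih h.pred).2 θ (.of_mem hθ)).alls n)
    · rintro φ ⟨_, hφ, e⟩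
      obtain ⟨n, θ, hθ, rfl⟩ := mem_pi_succ.1 hφ
      have hn := ((ih h.pred).1 θ (.of_mem hθ)).exs n
      -- The negation of `∀θ` is `¬¬∃¬θ`, and excluded middle for the `Σ_{j+1}` formula `∃¬θ`
      -- removes the double negation.
      exact (e.neg.trans ((alls_eqv _ (h.pred.1 θ hθ)).neg.trans
        (Eqv.of_stable (Proves.stable_of_dec (hn.dec h.1))).symm)).eqvIn hn

/-- Since `¬∃` is `∀¬` intuitionistically, only the matrix has to be negated; this gains one level
over `neg_form`. -/
theorem neg_sigma_succ (h : LEM T j) (hφ : EqvIn T φ (SigmaClass (j + 1))) :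
    EqvIn T φ.neg (PiClass (j + 1)) := by
  obtain ⟨φ', hφ, e⟩ := hφ
  obtain ⟨n, θ, hθ, rfl⟩ := mem_sigma_succ.1 hφ
  exact (e.neg.trans (Eqv.neg_exs _ _)).eqvIn ((h.neg_form.2 θ (.of_mem hθ)).alls n)

/-- A universal block over a decidable matrix is equivalent to a negation, and negations are stable.
-/
theorem stable_pi_succ (h : LEM T j) (hφ : EqvIn T φ (PiClass (j + 1))) :
    Proves T (imp φ.neg.neg φ) := by
  obtain ⟨φ', hφ, e⟩ := hφ
  obtain ⟨n, θ, hθ, rfl⟩ := mem_pi_succ.1 hφ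
  exact Proves.stable_congr (e.trans (alls_eqv _ (h.1 θ hθ))).symm.iff (Proves.stable_neg _)

theorem succ (h : LEM T j) (hs : ∀ φ ∈ SigmaClass (j + 1), Proves T (disj φ φ.neg)) :
    LEM T (j + 1) := by
  refine ⟨hs, fun φ hφ => ?_⟩
  obtain ⟨n, θ, hθ, rfl⟩ := mem_pi_succ.1 hφ
  have hn := ((h.neg_form.1 θ (.of_mem hθ)).exs n).dec hs
  exact Proves.dec_congr (alls_eqv (n + 1) (h.1 θ hθ)).symm.iff
    (Proves.dec_imp hn Proves.dec_falsum)

end LEM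

/-- Excluded middle for `Σ_{j+1}` is itself a disjunction of formulas equivalent to `Π_{j+2}` ones,
and its double negation is intuitionistically provable. -/
theorem DisjStable.lem {T : Set Formula} (hT : Extends T HA) {j : ℕ}
    (h : DisjStable T (j + 1)) : LEM T j := by
  induction j with
  | zero => exact LEM.zero hT
  | succ j ih =>
    have hj := ih h.pred
    refine hj.succ fun φ hφ => (h.eqvIn (EqvIn.of_mem hφ).pi_of_sigma ?_).mp
      (Proves.not_not_lem φ)
    obtain ⟨ψ, hψ, e⟩ := hj.neg_sigma_succ (.of_mem hφ)
    exact e.eqvIn ((EqvIn.succ _).2 ψ hψ)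

/-! ## Alternation paths -/

/-- All alternation paths of `φ` have length at most `k`, and none of those of length `k` begins
with `a`. -/
def PathsBelow (a : Sign) (k : ℕ) (φ : Formula) : Prop :=
  ∀ s ∈ altPaths φ, s.length ≤ k ∧ (s.length = k → s.head? ≠ some a)

theorem altPaths_nonempty (φ : Formula) : (altPaths φ).Nonempty := by
  induction φ with
  | falsum => exact ⟨[], by simp [altPaths]⟩
  | eq s t => exact ⟨[], by simp [altPaths]⟩
  | conj φ ψ h₁ _ => exact h₁.mono Finset.subset_union_left
  | disj φ ψ h₁ _ => exact h₁.mono Finset.subset_union_left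
  | imp φ ψ h₁ _ =>
    cases ψ <;> first | exact h₁.image _ | exact (h₁.image _).mono Finset.subset_union_left
  | all φ h => exact h.image _
  | ex φ h => exact h.image _

theorem length_dual (s : List Sign) : (dual s).length = s.length := List.length_map _

theorem head_dual (s : List Sign) (a : Sign) :
    (dual s).head? = some a ↔ s.head? = some a.flip := by
  cases s with
  | nil => simp [dual]
  | cons b s => cases a <;> cases b <;> simp [dual, Sign.flip]

theorem head_extend (a : Sign) (s : List Sign) : (extend a s).head? = some a := by
  rw [extend]
  split_ifs with h
  · exact h
  · rfl

namespace PathsBelow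

variable {a : Sign} {k : ℕ} {φ ψ : Formula}

theorem conj (h : PathsBelow a k (conj φ ψ)) : PathsBelow a k φ ∧ PathsBelow a k ψ :=
  ⟨fun s hs => h s (Finset.mem_union_left _ hs), fun s hs => h s (Finset.mem_union_right _ hs)⟩

theorem disj (h : PathsBelow a k (disj φ ψ)) : PathsBelow a k φ ∧ PathsBelow a k ψ :=
  ⟨fun s hs => h s (Finset.mem_union_left _ hs), fun s hs => h s (Finset.mem_union_right _ hs)⟩

theorem imp (h : PathsBelow a k (imp φ ψ)) : PathsBelow a.flip k φ ∧ PathsBelow a k ψ := by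
  have hφ : (altPaths φ).image dual ⊆ altPaths (Formula.imp φ ψ) := by
    cases ψ <;> first | exact Finset.Subset.refl _ | exact Finset.subset_union_left
  constructor
  · intro s hs
    have := h _ (hφ (Finset.mem_image_of_mem dual hs))
    rw [length_dual] at this
    exact ⟨this.1, fun hk ha => this.2 hk ((head_dual s a).2 ha)⟩
  · cases ψ with
    -- The paths of a negation do not include those of `⊥`; the empty path has no head and is
    -- harmless.
    | falsum =>
      intro s hs
      obtain rfl : s = [] := by simpa [altPaths] using hs
      exact ⟨Nat.zero_le _, fun _ => by simp⟩
    | _ => exact fun s hs => h s (Finset.mem_union_right _ hs)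

theorem of_image_extend {S : Finset (List Sign)} (b : Sign)
    (h : ∀ s ∈ S.image (extend b), s.length ≤ k ∧ (s.length = k → s.head? ≠ some a)) :
    ∀ s ∈ S, s.length ≤ k ∧ (s.length = k → s.head? ≠ some a) := by
  intro s hs
  have := h _ (Finset.mem_image_of_mem _ hs)
  by_cases hb : s.head? = some b
  · rwa [extend, if_pos hb] at this
  · rw [extend, if_neg hb, List.length_cons] at this
    exact ⟨by omega, by omega⟩

theorem all (h : PathsBelow a k (all φ)) : PathsBelow a k φ := of_image_extend _ h

theorem ex (h : PathsBelow a k (ex φ)) : PathsBelow a k φ := of_image_extend _ h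

/-- After a quantifier every path begins with its sign `a`, and such paths may not have the full
length `k`. So the level drops by one, and the restriction can be switched to the other sign. -/
theorem lower {S : Finset (List Sign)} {a b : Sign} (hab : a ≠ b) (hS : S.Nonempty)
    (h : ∀ s ∈ S.image (extend a), s.length ≤ k ∧ (s.length = k → s.head? ≠ some a)) :
    ∃ j, k = j + 1 ∧ ∀ s ∈ S.image (extend a),
      s.length ≤ j ∧ (s.length = j → s.head? ≠ some b) := by
  have key : ∀ s ∈ S.image (extend a), s.length < k ∧ s.head? = some a := by
    intro s hs
    have hs' := hs
    obtain ⟨t, -, rfl⟩ := Finset.mem_image.1 hs'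
    exact ⟨lt_of_le_of_ne (h _ hs).1 fun e => (h _ hs).2 e (head_extend a t), head_extend a t⟩
  obtain ⟨t, ht⟩ := hS
  have hk := (key _ (Finset.mem_image_of_mem _ ht)).1
  refine ⟨k - 1, by omega, fun s hs => ?_⟩
  obtain ⟨h₁, h₂⟩ := key s hs
  exact ⟨by omega, fun _ e => hab (Option.some.inj (h₂.symm.trans e))⟩

theorem lower_all (h : PathsBelow .minus k (Formula.all φ)) :
    ∃ j, k = j + 1 ∧ PathsBelow .plus j (Formula.all φ) :=
  lower (by simp) (altPaths_nonempty φ) h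

theorem lower_ex (h : PathsBelow .plus k (Formula.ex φ)) :
    ∃ j, k = j + 1 ∧ PathsBelow .minus j (Formula.ex φ) :=
  lower (by simp) (altPaths_nonempty φ) h

theorem qf (h : PathsBelow a 0 φ) : φ.QF := by
  have not_quant : ∀ {b φ}, ¬ ∀ s ∈ (altPaths φ).image (extend b), s.length ≤ 0 := by
    intro b φ h
    obtain ⟨s, hs⟩ := altPaths_nonempty φ
    have h₁ := h _ (Finset.mem_image_of_mem (extend b) hs)
    have h₂ := head_extend b s
    rw [List.length_eq_zero_iff.1 (Nat.le_zero.1 h₁)] at h₂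
    simp at h₂
  induction φ generalizing a with
  | falsum => trivial
  | eq s t => trivial
  | conj φ ψ h₁ h₂ => exact ⟨h₁ h.conj.1, h₂ h.conj.2⟩
  | disj φ ψ h₁ h₂ => exact ⟨h₁ h.disj.1, h₂ h.disj.2⟩
  | imp φ ψ h₁ h₂ => exact ⟨h₁ h.imp.1, h₂ h.imp.2⟩
  | all φ _ => exact not_quant fun s hs => (h s hs).1
  | ex φ _ => exact not_quant fun s hs => (h s hs).1

end PathsBelow

theorem length_le_of_degree_le {φ : Formula} {k : ℕ} (h : degree φ = k) :
    ∀ s ∈ altPaths φ, s.length ≤ k := fun _ hs => h ▸ Finset.le_sup (f := List.length) hs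

/-- A subformula may have smaller degree, so `UClass` is unsuitable for induction on formulas.
`PathsBelow` admits lower degrees and passes to subformulas, with the sign flipped in antecedents.
-/
theorem pathsBelow_of_mem_UClass {φ : Formula} {k : ℕ} (h : φ ∈ UClass k) :
    PathsBelow .plus k φ := by
  cases k with
  | zero =>
    intro s hs
    have := length_le_of_degree_le (k := 0) h s hs
    refine ⟨this, fun h₀ => ?_⟩
    rw [List.length_eq_zero_iff.1 h₀]
    simp
  | succ k =>
    intro s hs
    refine ⟨length_le_of_degree_le h.1 s hs, fun hk => ?_⟩
    rw [h.2 s hs hk]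
    simp

theorem altPaths_sigma_pi (j : ℕ) :
    (∀ φ ∈ SigmaClass j, ∀ s ∈ altPaths φ, s.length = j ∧ s.head? ≠ some .minus) ∧
      ∀ φ ∈ PiClass j, ∀ s ∈ altPaths φ, s.length = j ∧ s.head? ≠ some .plus := by
  induction j with
  | zero =>
    constructor
    · intro φ hφ s hs
      rw [altPaths_of_QF φ (mem_sigma_zero.1 hφ), Finset.mem_singleton] at hs
      simp [hs]
    · intro φ hφ s hs
      rw [altPaths_of_QF φ (mem_pi_zero.1 hφ), Finset.mem_singleton] at hs
      simp [hs]
  | succ j ih =>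
    -- The first alternative is the innermost quantifier of a new block, which lengthens paths; the
    -- second is a further quantifier of the same block, which leaves them unchanged.
    have step : ∀ (a : Sign) (S : Finset (List Sign)),
        (∀ s ∈ S, (s.length = j ∧ s.head? ≠ some a) ∨ (s.length = j + 1 ∧ s.head? = some a)) →
        ∀ s ∈ S.image (extend a), s.length = j + 1 ∧ s.head? = some a := by
      intro a S hS s hs
      obtain ⟨t, ht, rfl⟩ := Finset.mem_image.1 hs
      refine ⟨?_, head_extend a t⟩
      rcases hS t ht with ⟨h₁, h₂⟩ | ⟨h₁, h₂⟩
      · rw [extend, if_neg h₂, List.length_cons, h₁]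
      · rw [extend, if_pos h₂, h₁]
    constructor
    · intro φ hφ
      obtain ⟨n, θ, hθ, rfl⟩ := mem_sigma_succ.1 hφ
      have key : ∀ s ∈ altPaths (exs (n + 1) θ), s.length = j + 1 ∧ s.head? = some .plus := by
        clear hφ
        induction n with
        | zero => exact step _ _ fun s hs => Or.inl (ih.2 θ hθ s hs)
        | succ n ihn => exact step _ _ fun s hs => Or.inr (ihn s hs)
      exact fun s hs => ⟨(key s hs).1, by simp [(key s hs).2]⟩
    · intro φ hφ
      obtain ⟨n, θ, hθ, rfl⟩ := mem_pi_succ.1 hφ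
      have key : ∀ s ∈ altPaths (alls (n + 1) θ), s.length = j + 1 ∧ s.head? = some .minus := by
        clear hφ
        induction n with
        | zero => exact step _ _ fun s hs => Or.inl (ih.1 θ hθ s hs)
        | succ n ihn => exact step _ _ fun s hs => Or.inr (ihn s hs)
      exact fun s hs => ⟨(key s hs).1, by simp [(key s hs).2]⟩

/-- Equal levels serve the instances of the scheme; the lower level of `ψ` serves `φ ∨ ¬φ`. -/
theorem disj_mem_UClass {φ ψ : Formula} {k : ℕ} (hφ : φ ∈ PiClass (k + 1))
    (hψ : ψ ∈ PiClass (k + 1) ∨ ψ ∈ PiClass k) : disj φ ψ ∈ UClass (k + 1) := by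
  have h₁ := (altPaths_sigma_pi (k + 1)).2 φ hφ
  have h₂ : ∀ s ∈ altPaths ψ, s.length ≤ k + 1 ∧ (s.length = k + 1 → s.head? ≠ some .plus) := by
    intro s hs
    rcases hψ with hψ | hψ
    · have := (altPaths_sigma_pi _).2 ψ hψ s hs
      exact ⟨this.1.le, fun _ => this.2⟩
    · have := (altPaths_sigma_pi _).2 ψ hψ s hs
      exact ⟨by omega, by omega⟩
  have h₃ : ∀ s ∈ altPaths (disj φ ψ),
      s.length ≤ k + 1 ∧ (s.length = k + 1 → s.head? ≠ some .plus) := by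
    intro s hs
    rcases Finset.mem_union.1 hs with hs | hs
    · exact ⟨(h₁ s hs).1.le, fun _ => (h₁ s hs).2⟩
    · exact h₂ s hs
  refine ⟨le_antisymm (Finset.sup_le fun s hs => (h₃ s hs).1) ?_, fun s hs hk => ?_⟩
  · obtain ⟨s, hs⟩ := altPaths_nonempty φ
    exact (h₁ s hs).1.ge.trans (Finset.le_sup (f := List.length) (Finset.mem_union_left _ hs))
  · have := (h₃ s hs).2 hk
    cases s with
    | nil => simp at hk
    | cons a s => cases a <;> simp_all

/-! ## Prenex normal forms -/

/-- Prenex normal forms under the law of excluded middle for `Σ_m`. -/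
theorem LEM.prenex {T : Set Formula} {m : ℕ} (h : LEM T m) (φ : Formula) :
    (PathsBelow .plus m φ → EqvIn T φ (PiClass m)) ∧
      (PathsBelow .minus m φ → EqvIn T φ (SigmaClass m)) := by
  induction m generalizing φ with
  | zero => exact ⟨fun hφ => (EqvIn.of_QF hφ.qf 0).2, fun hφ => (EqvIn.of_QF hφ.qf 0).1⟩
  | succ m ihm =>
    have hconj := conj_closed (T := T) (m + 1)
    have hdisj := disj_closed h.disjStable
    induction φ with
    | falsum =>
      exact ⟨fun _ => (EqvIn.of_QF (φ := falsum) trivial _).2,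
        fun _ => (EqvIn.of_QF (φ := falsum) trivial _).1⟩
    | eq s t =>
      exact ⟨fun _ => (EqvIn.of_QF (φ := eq s t) trivial _).2,
        fun _ => (EqvIn.of_QF (φ := eq s t) trivial _).1⟩
    | conj φ ψ h₁ h₂ =>
      exact ⟨fun H => hconj.2 _ _ (h₁.1 H.conj.1) (h₂.1 H.conj.2),
        fun H => hconj.1 _ _ (h₁.2 H.conj.1) (h₂.2 H.conj.2)⟩
    | disj φ ψ h₁ h₂ =>
      exact ⟨fun H => hdisj.2 _ _ (h₁.1 H.disj.1) (h₂.1 H.disj.2),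
        fun H => hdisj.1 _ _ (h₁.2 H.disj.1) (h₂.2 H.disj.2)⟩
    | imp φ ψ h₁ h₂ =>
      constructor
      · intro H
        have hφ := h₁.2 H.imp.1
        have hψ := h₂.1 H.imp.2
        exact (Eqv.imp_disj (Proves.stable_of_dec (Proves.dec_disj (Proves.dec_imp (hφ.dec h.1)
          Proves.dec_falsum) (hψ.dec h.2)))).eqvIn (hdisj.2 _ _ (h.neg_form.1 _ hφ) hψ)
      · intro H
        have hφ := h₁.1 H.imp.1
        have hψ := h₂.2 H.imp.2
        exact (Eqv.imp_disj (Proves.stable_of_dec (Proves.dec_disj (Proves.dec_imp (hφ.dec h.2)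
          Proves.dec_falsum) (hψ.dec h.1)))).eqvIn (hdisj.1 _ _ (h.neg_form.2 _ hφ) hψ)
    | all φ ih =>
      refine ⟨fun H => (ih.1 H.all).all, fun H => ?_⟩
      -- On the wrong side the whole quantified formula already lies one level lower, so the
      -- hypothesis on `m` applies to it rather than to its body.
      obtain ⟨j, hj, H⟩ := H.lower_all
      cases hj
      exact ((ihm h.pred _).1 H).sigma_of_pi
    | ex φ ih =>
      refine ⟨fun H => ?_, fun H => (ih.2 H.ex).ex⟩
      obtain ⟨j, hj, H⟩ := H.lower_ex
      cases hj
      exact ((ihm h.pred _).2 H).pi_of_sigma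

/-- Prenex normal forms if disjunctions of `Π_{k+1}` formulas are stable. -/
theorem DisjStable.prenex {T : Set Formula} (hT : Extends T HA) {k : ℕ}
    (h : DisjStable T (k + 1)) (φ : Formula) :
    (PathsBelow .plus (k + 1) φ → EqvIn T φ (PiClass (k + 1))) ∧
      (PathsBelow .minus (k + 1) φ → EqvIn T φ.neg (PiClass (k + 1))) := by
  -- Excluded middle is available only up to `k`. Hence the second half at level `k + 1` concerns
  -- `¬φ` and does not claim a `Σ_{k+1}` form of `φ`.
  have hk := h.lem hT
  have hconj := (conj_closed (T := T) (k + 1)).2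
  have hdisj := (disj_closed h).2
  induction φ with
  | falsum =>
    exact ⟨fun _ => (EqvIn.of_QF (φ := falsum) trivial _).2,
      fun _ => (EqvIn.of_QF (φ := falsum.neg) ⟨trivial, trivial⟩ _).2⟩
  | eq s t =>
    exact ⟨fun _ => (EqvIn.of_QF (φ := eq s t) trivial _).2,
      fun _ => (EqvIn.of_QF (φ := (eq s t).neg) ⟨trivial, trivial⟩ _).2⟩
  | conj φ ψ h₁ h₂ =>
    refine ⟨fun H => hconj _ _ (h₁.1 H.conj.1) (h₂.1 H.conj.2), fun H => ?_⟩
    have hφ := h₁.2 H.conj.1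
    have hψ := h₂.2 H.conj.2
    exact (Eqv.neg_conj (h.eqvIn hφ hψ)).eqvIn (hdisj _ _ hφ hψ)
  | disj φ ψ h₁ h₂ =>
    exact ⟨fun H => hdisj _ _ (h₁.1 H.disj.1) (h₂.1 H.disj.2),
      fun H => (Eqv.neg_disj φ ψ).eqvIn (hconj _ _ (h₁.2 H.disj.1) (h₂.2 H.disj.2))⟩
  | imp φ ψ h₁ h₂ =>
    constructor
    · intro H
      have hφ := h₁.2 H.imp.1
      have hψ := h₂.1 H.imp.2
      exact (Eqv.imp_disj (h.eqvIn hφ hψ)).eqvIn (hdisj _ _ hφ hψ)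
    · intro H
      have hφ := h₁.1 H.imp.1
      -- Extracting `φ` from `¬(φ → ψ)` needs its stability, which holds since `φ` is equivalent to
      -- a `Π_{k+1}` formula.
      exact (Eqv.neg_imp (hk.stable_pi_succ hφ)).eqvIn (hconj _ _ hφ (h₂.2 H.imp.2))
  | all φ ih =>
    refine ⟨fun H => (ih.1 H.all).all, fun H => ?_⟩
    obtain ⟨j, hj, H⟩ := H.lower_all
    cases hj
    exact (hk.neg_form.2 _ ((hk.prenex _).1 H)).pi_of_sigma
  | ex φ ih =>
    refine ⟨fun H => ?_, fun H => (Eqv.neg_ex φ).eqvIn (ih.2 H.ex).all⟩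
    obtain ⟨j, hj, H⟩ := H.lower_ex
    cases hj
    exact ((hk.prenex _).2 H).pi_of_sigma

/-! ## Friedman's negative translation -/

namespace Formula

/-- Double negation relative to `A`. -/
abbrev nn (A φ : Formula) : Formula := imp (imp φ A) A

/-- The negative translation in which `A` takes the place of `⊥`. -/
def ftrans : Formula → Formula → Formula
  | falsum, A => A
  | eq s t, A => nn A (eq s t)
  | conj φ ψ, A => conj (ftrans φ A) (ftrans ψ A)
  | disj φ ψ, A => nn A (disj (ftrans φ A) (ftrans ψ A))
  | imp φ ψ, A => imp (ftrans φ A) (ftrans ψ A)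
  | all φ, A => all (ftrans φ A.shift)
  | ex φ, A => nn A (ex (ftrans φ A.shift))

theorem ftrans_subst (φ A : Formula) (σ : ℕ → Tm) :
    (φ.ftrans A).subst σ = (φ.subst σ).ftrans (A.subst σ) := by
  induction φ generalizing A σ with
  | falsum => rfl
  | eq s t => rfl
  | conj φ ψ h₁ h₂ => simp [ftrans, subst, h₁, h₂]
  | disj φ ψ h₁ h₂ => simp [ftrans, subst, h₁, h₂]
  | imp φ ψ h₁ h₂ => simp [ftrans, subst, h₁, h₂]
  | all φ h => simp [ftrans, subst, h, shift_subst]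
  | ex φ h => simp [ftrans, subst, h, shift_subst]

theorem ftrans_inst (φ A : Formula) (t : Tm) :
    (φ.inst t).ftrans A = (φ.ftrans A.shift).inst t := by
  rw [inst, inst, ftrans_subst]
  congr 1
  exact (shift_inst A t).symm

theorem ftrans_succSub (φ A : Formula) :
    (φ.subst succSub).ftrans A.shift = (φ.ftrans A.shift).subst succSub := by
  rw [ftrans_subst]
  congr 1
  rw [shift, subst_subst]
  rfl

theorem ftrans_shift (φ A : Formula) : φ.shift.ftrans A.shift = (φ.ftrans A).shift :=
  (ftrans_subst φ A _).symm

theorem map_ftrans_shift (Γ : List Formula) (A : Formula) :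
    (Γ.map shift).map (fun φ => φ.ftrans A.shift) = (Γ.map fun φ => φ.ftrans A).map shift := by
  simp [ftrans_shift]

end Formula

namespace Derives

variable {T : Set Formula} {Γ : List Formula} {φ ψ A : Formula}

theorem nn_intro (h : Derives T Γ φ) : Derives T Γ (nn A φ) := impI (impE hyp0 h.wk)

/-- This is what lets `A` act as falsity: translated formulas follow from `A`, and relative double
negations may be stripped when proving them. -/
theorem ftrans_stable (φ A : Formula) : Proves T (imp (nn A (φ.ftrans A)) (φ.ftrans A)) := by
  induction φ generalizing A with
  | falsum => exact impI (impE hyp0 (impI hyp0))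
  | eq s t => exact impI (impI (impE hyp1 (impI (impE hyp0 hyp1))))
  | conj φ ψ h₁ h₂ =>
    exact impI (andI (impE (h₁ A).wk (impI (impE hyp1 (impI (impE hyp1 (andE₁ hyp0))))))
      (impE (h₂ A).wk (impI (impE hyp1 (impI (impE hyp1 (andE₂ hyp0)))))))
  | disj φ ψ h₁ h₂ => exact impI (impI (impE hyp1 (impI (impE hyp0 hyp1))))
  | imp φ ψ h₁ h₂ =>
    exact impI (impI (impE (h₂ A).wk (impI (impE hyp2 (impI (impE hyp1 (impE hyp0 hyp2)))))))
  | all φ h =>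
    exact impI (allI (impE (h A.shift).wk
      (impI (impE hyp1 (impI (impE hyp1 (allE_shift hyp0)))))))
  | ex φ h => exact impI (impI (impE hyp1 (impI (impE hyp0 hyp1))))

theorem ftrans_bind (h : Derives T Γ (nn A φ)) (h' : Derives T (φ :: Γ) (ψ.ftrans A)) :
    Derives T Γ (ψ.ftrans A) :=
  (ftrans_stable ψ A).wk.impE (impI (impE h.wk (impI (impE hyp1
    (h'.mono (List.cons_subset_cons _ (List.subset_cons_self _ _)))))))

theorem ftrans_of_param (h : Derives T Γ A) : Derives T Γ (φ.ftrans A) :=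
  (ftrans_stable φ A).wk.impE (impI h.wk)

theorem ftrans_HA (h : φ ∈ HA) (A : Formula) : Proves HA (φ.ftrans A) := by
  cases h with
  | eqRefl t => exact nn_intro (ax (.eqRefl t))
  | eqSubst φ s t =>
    rw [ftrans, ftrans, ftrans, ftrans_inst, ftrans_inst]
    refine impI (impI ?_)
    -- The goal must have the form of a translation for `ftrans_bind` to strip the double negation
    -- from the equation.
    rw [← ftrans_inst φ A t]
    refine ftrans_bind hyp1 ?_
    rw [ftrans_inst]
    exact eq_inst _ hyp0 hyp1
  | succNeZero t => exact impI (impE hyp0 (impI (falsumE (impE (ax (.succNeZero t)) hyp0))))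
  | succInj s t =>
    exact impI (impI (impE hyp1 (impI (impE hyp1 (impE (ax (.succInj s t)) hyp0)))))
  | projDef i ts => exact nn_intro (ax (.projDef i ts))
  | compDef f g ts => exact nn_intro (ax (.compDef f g ts))
  | precZero f g ts => exact nn_intro (ax (.precZero f g ts))
  | precSucc f g y ts => exact nn_intro (ax (.precSucc f g y ts))
  | induction φ =>
    rw [ftrans, ftrans, ftrans, ftrans, ftrans_inst, ftrans_succSub]
    exact ax (.induction _)

/-- The translation turns classical derivations into intuitionistic ones. -/
theorem ftrans (h : Derives PA Γ φ) (A : Formula) :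
    Derives HA (Γ.map fun ψ => ψ.ftrans A) (φ.ftrans A) := by
  induction h generalizing A with
  | @ax Γ φ h =>
    rcases h with h | ⟨φ, rfl⟩
    · exact (ftrans_HA h A).wk
    -- The translated excluded middle is a double negation relative to `A`, valid for the same
    -- reason as `¬¬(φ ∨ ¬φ)`.
    · exact impI (impE hyp0 (orI₂ (impI (impE hyp1 (orI₁ hyp0)))))
  | hyp h => exact hyp (List.mem_map_of_mem h)
  | falsumE _ ih => exact ftrans_of_param (ih A)
  | andI _ _ ih₁ ih₂ => exact andI (ih₁ A) (ih₂ A)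
  | andE₁ _ ih => exact andE₁ (ih A)
  | andE₂ _ ih => exact andE₂ (ih A)
  | orI₁ _ ih => exact nn_intro (orI₁ (ih A))
  | orI₂ _ ih => exact nn_intro (orI₂ (ih A))
  | orE _ _ _ ih ih₁ ih₂ =>
    exact ftrans_bind (ih A) (orE hyp0 ((ih₁ A).mono (List.cons_subset_cons _
      (List.subset_cons_self _ _))) ((ih₂ A).mono (List.cons_subset_cons _
      (List.subset_cons_self _ _))))
  | impI _ ih => exact impI (ih A)
  | impE _ _ ih₁ ih₂ => exact impE (ih₁ A) (ih₂ A)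
  | allI _ ih =>
    refine allI ?_
    rw [← map_ftrans_shift]
    exact ih A.shift
  | allE t _ ih =>
    rw [ftrans_inst]
    exact allE t (ih A)
  | exI t _ ih =>
    refine nn_intro (exI t ?_)
    rw [← ftrans_inst]
    exact ih A
  | exE _ _ ih₁ ih₂ =>
    refine ftrans_bind (ih₁ A) (exE hyp0 ?_)
    rw [← ftrans_shift]
    refine (ih₂ A.shift).mono ?_
    rw [List.map_cons, map_ftrans_shift]
    exact List.cons_subset_cons _ (List.subset_cons_self _ _)

end Derives

/-! ## Conservativity of classical arithmetic -/

/-- In `T`, the translation of `φ` is equivalent to `φ ∨ A`, for all `A`. -/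
def FtransDisj (T : Set Formula) (φ : Formula) : Prop :=
  ∀ A, Proves T ((φ.ftrans A).iff (disj φ A))

namespace FtransDisj

variable {T : Set Formula} {φ ψ : Formula}

/-- If `φ` fails, then `φ ∨ A` implies `A`, so the relative double negation yields `A`. -/
theorem nn_disj (h : Proves T (Formula.disj φ φ.neg)) (A : Formula) :
    Proves T ((nn A (Formula.disj φ A)).iff (Formula.disj φ A)) :=
  andI (impI (cases h (orI₁ hyp0) (orI₂ (impE hyp1 (impI (orE hyp0 (falsumE (impE hyp2 hyp0))
    hyp0)))))) (impI (nn_intro hyp0))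

theorem of_nn (h : Proves T (Formula.disj φ φ.neg)) {A : Formula}
    (e : Proves T (ψ.iff (Formula.disj φ A))) :
    Proves T ((nn A ψ).iff (Formula.disj φ A)) :=
  ((e.iff_imp (Proves.iff_refl _)).iff_imp (Proves.iff_refl _)).iff_trans (nn_disj h A)

theorem ofQF (hT : Extends T HA) (hφ : φ.QF) : FtransDisj T φ := by
  have dec : ∀ {φ : Formula}, φ.QF → Proves T (Formula.disj φ φ.neg) :=
    fun h => hT _ (Proves.dec_of_QF h)
  intro A
  induction φ with
  | falsum => exact andI (impI (orI₂ hyp0)) (impI (orE hyp0 (falsumE hyp0) hyp0))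
  | eq s t =>
    exact andI (impI (cases (dec hφ) (orI₁ hyp0)
        (orI₂ (impE hyp1 (impI (falsumE (impE hyp1 hyp0)))))))
      (impI (orE hyp0 (nn_intro hyp0) (impI hyp1)))
  | conj φ ψ h₁ h₂ =>
    refine ((h₁ hφ.1).iff_conj (h₂ hφ.2)).iff_trans (andI (impI ?_) (impI ?_))
    · exact orE (andE₁ hyp0) (orE (andE₂ hyp1) (orI₁ (andI hyp1 hyp0)) (orI₂ hyp0)) (orI₂ hyp0)
    · exact orE hyp0 (andI (orI₁ (andE₁ hyp0)) (orI₁ (andE₂ hyp0))) (andI (orI₂ hyp0) (orI₂ hyp0))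
  | disj φ ψ h₁ h₂ =>
    refine of_nn (dec (φ := Formula.disj φ ψ) hφ)
      (((h₁ hφ.1).iff_disj (h₂ hφ.2)).iff_trans (andI (impI ?_) (impI ?_)))
    · exact orE hyp0 (orE hyp0 (orI₁ (orI₁ hyp0)) (orI₂ hyp0))
        (orE hyp0 (orI₁ (orI₂ hyp0)) (orI₂ hyp0))
    · exact orE hyp0 (orE hyp0 (orI₁ (orI₁ hyp0)) (orI₂ (orI₁ hyp0))) (orI₁ (orI₂ hyp0))
  | imp φ ψ h₁ h₂ =>
    refine ((h₁ hφ.1).iff_imp (h₂ hφ.2)).iff_trans (andI (impI ?_) (impI (impI ?_)))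
    · exact cases (dec hφ.1) (orE (impE hyp1 (orI₁ hyp0)) (orI₁ (impI hyp1)) (orI₂ hyp0))
        (orI₁ (impI (falsumE (impE hyp1 hyp0))))
    · exact orE hyp1 (orE hyp1 (orI₁ (impE hyp1 hyp0)) (orI₂ hyp0)) (orI₂ hyp0)
  | all φ _ => exact hφ.elim
  | ex φ _ => exact hφ.elim

theorem ex (h : FtransDisj T φ) (hd : Proves T (Formula.disj (ex φ) (ex φ).neg)) :
    FtransDisj T (ex φ) := fun A =>
  of_nn hd ((h A.shift).iff_ex.iff_trans (Eqv.disj_ex φ A).symm.iff)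

/-- Passing from `∀(φ ∨ A)` to `∀φ ∨ A` is done by deciding whether a counterexample to `φ` exists:
if so, it forces `A`. -/
theorem all (h : FtransDisj T φ) (hφ : Proves T (Formula.disj φ φ.neg))
    (hd : Proves T (Formula.disj (Formula.ex φ.neg) (Formula.ex φ.neg).neg)) :
    FtransDisj T (all φ) := by
  intro A
  refine (h A.shift).iff_all.iff_trans (andI (impI (cases hd ?_ ?_)) (impI ?_))
  · exact orI₂ (exE hyp0 (orE (allE_shift hyp2) (falsumE (impE hyp1 hyp0)) hyp0))
  · exact orI₁ (allI (cases hφ hyp0 (falsumE (impE hyp1 (exI_shift hyp0)))))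
  · exact allI (orE hyp0 (orI₁ (allE_shift hyp0)) (orI₂ hyp0))

end FtransDisj

theorem EqvIn.exs_sigma {T : Set Formula} {j : ℕ} {φ : Formula} (h : φ ∈ PiClass j) (n : ℕ) :
    EqvIn T (SemiClassical.exs n φ) (SigmaClass (j + 1)) := by
  cases n with
  | zero => exact (EqvIn.of_mem h).sigma_of_pi
  | succ n => exact (EqvIn.of_mem h).exs n

theorem LEM.ftransDisj {T : Set Formula} (hT : Extends T HA) {j : ℕ} (h : LEM T j) :
    (∀ φ ∈ SigmaClass j, FtransDisj T φ) ∧ ∀ φ ∈ PiClass j, FtransDisj T φ := by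
  induction j with
  | zero =>
    exact ⟨fun φ hφ => .ofQF hT (mem_sigma_zero.1 hφ), fun φ hφ => .ofQF hT (mem_pi_zero.1 hφ)⟩
  | succ j ih =>
    constructor
    · intro φ hφ
      obtain ⟨n, θ, hθ, rfl⟩ := mem_sigma_succ.1 hφ
      have key : ∀ m, FtransDisj T (exs m θ) := by
        intro m
        induction m with
        | zero => exact (ih h.pred).2 θ hθ
        | succ m ihm => exact ihm.ex ((EqvIn.exs_sigma hθ (m + 1)).dec h.1)
      exact key _
    · intro φ hφ
      obtain ⟨n, θ, hθ, rfl⟩ := mem_pi_succ.1 hφ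
      have key : ∀ m, FtransDisj T (alls m θ) := by
        intro m
        induction m with
        | zero => exact (ih h.pred).1 θ hθ
        | succ m ihm =>
          have hm := EqvIn.alls_pi (T := T) hθ m
          exact ihm.all (hm.dec h.2) ((h.neg_form.2 _ hm).ex.dec h.1)
      exact key _

/-- The existential block itself need not be decidable, so only its relative double negation is
obtained. -/
theorem ftrans_exs {T : Set Formula} {θ : Formula} (h : FtransDisj T θ) (m : ℕ) (A : Formula) :
    Proves T (imp ((exs m θ).ftrans A) (nn A (exs m θ))) := by
  induction m generalizing A with
  | zero => exact impI (orE ((h A).iff_mp hyp0) (nn_intro hyp0) (impI hyp1))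
  | succ m ih =>
    exact impI (impI (impE hyp1 (impI (exE hyp0 (impE (impE (ih A.shift).wk hyp0)
      (impI (impE (hyp (φ := (imp (exs (m + 1) θ) A).shift) (by simp)) (exI_shift hyp0))))))))

theorem Proves.of_alls {T : Set Formula} {φ : Formula} (n : ℕ) (h : Proves T (alls n φ)) :
    Proves T φ := by
  induction n with
  | zero => exact h
  | succ n ih => exact ih h.of_all

theorem Proves.alls {T : Set Formula} {φ : Formula} (n : ℕ) (h : Proves T φ) :
    Proves T (alls n φ) := by
  induction n with
  | zero => exact h
  | succ n ih => exact ih.all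

/-- Classical arithmetic is `Π_{j+2}`-conservative over `Σ_j`-LEM. -/
theorem LEM.conservative {T : Set Formula} (hT : Extends T HA) {j : ℕ} (h : LEM T j)
    {χ : Formula} (hχ : χ ∈ PiClass (j + 2)) (hp : Proves PA χ) : Proves T χ := by
  obtain ⟨n, ψ, hψ, rfl⟩ := mem_pi_succ.1 hχ
  obtain ⟨m, θ, hθ, rfl⟩ := mem_sigma_succ.1 hψ
  -- Friedman's trick: with `A` chosen as the existential formula `E` itself, `(E → A) → A` becomes
  -- `(E → E) → E`, which gives `E`.
  have h₁ := hT _ (Derives.ftrans (hp.of_alls (n + 1)) (exs (m + 1) θ))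
  have h₂ := (ftrans_exs ((h.ftransDisj hT).2 θ hθ) (m + 1) (exs (m + 1) θ)).mp h₁
  exact (h₂.mp (impI hyp0)).alls (n + 1)

-- The equivalence of the scheme with prenex normal forms

theorem lem_of_PNFT {T : Set Formula} (hHA : Extends T HA) (hPA : Extends PA T) {k : ℕ}
    (h : ∀ k' ≤ k + 1, PNFT T (UClass k') (PiClass k')) : LEM T k := by
  induction k with
  | zero => exact LEM.zero hHA
  | succ k ih =>
    have hk := ih fun k' hk' => h k' (by omega)
    refine hk.succ fun φ hφ => ?_
    obtain ⟨ψ, hψ, e⟩ := hk.neg_sigma_succ (.of_mem hφ)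
    -- A vacuous universal quantifier raises `φ` to `Π_{k+2}`, so that its disjunction with the
    -- `Π_{k+1}` form of `¬φ` lies in `U_{k+2}`.
    obtain ⟨χ, hχ, hfv, e'⟩ := h (k + 2) le_rfl _
      (disj_mem_UClass (alls_mem_pi 0 (sigma_shift hφ)) (Or.inr hψ))
    have e'' : Proves T ((disj φ φ.neg).iff χ) :=
      ((Eqv.all_shift φ).disj e).iff.iff_trans e'
    -- The equivalence with `χ` also holds in `PA`, which therefore proves `χ`; conservativity
    -- brings `χ` back to `T`.
    exact e''.iff_mpr (hk.conservative hHA hχ ((hPA _ e'').iff_mp (ax (Or.inr ⟨φ, rfl⟩))))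

theorem orDNE_iff_PNFT {T : Set Formula} (hHA : Extends T HA) (hPA : Extends PA T) (k : ℕ) :
    ProvesScheme T (OrDNE (PiClass k) (PiClass k)) ↔
      ∀ k' ≤ k, PNFT T (UClass k') (PiClass k') := by
  constructor
  · intro h k' hk' φ hφ
    have hφ := pathsBelow_of_mem_UClass hφ
    have hs := (disjStable_of_orDNE hHA h).of_le hk'
    have : EqvIn T φ (PiClass k') := by
      cases k' with
      | zero => exact .of_mem (mem_pi_zero.2 hφ.qf)
      | succ k' => exact (hs.prenex hHA φ).1 hφ
    exact this.imp fun _ h => ⟨h.1, h.2.fv, h.2.iff⟩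
  · rintro h _ ⟨φ, hφ, ψ, hψ, -, -, rfl⟩
    refine Proves.all ?_
    cases k with
    | zero => exact (LEM.zero hHA).disjStable φ hφ ψ hψ
    | succ k =>
      obtain ⟨χ, hχ, -, e⟩ := h (k + 1) le_rfl _ (disj_mem_UClass hφ (Or.inl hψ))
      -- The disjunction inherits stability from its equivalent `Π_{k+1}` formula.
      exact Proves.stable_congr e.iff_symm
        ((lem_of_PNFT hHA hPA h).stable_pi_succ (.of_mem hχ))

end SemiClassical

theorem mainTheorem4 (T : Set SemiClassical.Formula)
    (hHA : SemiClassical.Extends T SemiClassical.HA)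
    (hPA : SemiClassical.Extends SemiClassical.PA T) (k : ℕ) :
    SemiClassical.ProvesScheme T
        (SemiClassical.OrDNE (SemiClassical.PiClass k) (SemiClassical.PiClass k)) ↔
      ∀ k' ≤ k, SemiClassical.PNFT T (SemiClassical.UClass k') (SemiClassical.PiClass k') :=
  SemiClassical.orDNE_iff_PNFT hHA hPA k
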